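/- Let $f\colon X\to S$ be a differentially smooth morphism of schemes: $\Omega^1_{X/S}$ is locally free of finite rank and the canonical map $\operatorname{Sym}_{\mathcal O_X}(\Omega^1_{X/S})\to\bigoplus_{n\ge 0}\mathcal I^n/\mathcal I^{n+1}$ is an isomorphism, where $\mathcal I$ is the ideal sheaf of the diagonal $X\to X\times_S X$ (in an open subscheme of $X\times_S X$ in which the diagonal is closed). Let $\mathcal E$ be a locally free $\mathcal O_X$-module of finite rank and let $k\ge 1$ be an integer. Let $X^{(k)}$ be the $k$-th infinitesimal neighbourhood of the diagonal, that is, the closed subscheme defined by $\mathcal I^{k+1}$, with its two projections $p,q\colon X^{(k)}\to X$, which coincide on the underlying topological spaces. Let $\mathcal J^k(\mathcal E)$ be the sheaf of principal parts of $\mathcal E$, with its left and its right $\mathcal O_X$-module structure: $$\mathcal J^k(\mathcal E)^{left}=p_*q^*\mathcal E,\qquad \mathcal J^k(\mathcal E)^{right}=q_*q^*\mathcal E .$$ Then $\mathcal J^k(\mathcal E)^{left}$ and $\mathcal J^k(\mathcal E)^{right}$ are locally free $\mathcal O_X$-modules of finite rank, and $$[\mathcal J^k(\mathcal E)^{left}]=[\mathcal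 J^k(\mathcal E)^{right}]$$ in the Grothendieck group $K(X)$ of locally free $\mathcal O_X$-modules of finite rank, i.e. the free abelian group on these modules modulo the relations $[\mathcal M]=[\mathcal M']+[\mathcal M'']$ for all short exact sequences $0\to\mathcal M'\to\mathcal M\to\mathcal M''\to 0$ of such modules. -/

import Mathlib

open CategoryTheory AlgebraicGeometry
open scoped TensorProduct

universe u

noncomputable section

/-! ### Differentially smooth morphisms -/

section Ring

/-- The associated graded ring `⨁ₙ Iⁿ / Iⁿ⁺¹` of an ideal `I` of `B`: the quotient of the Rees algebra
`⨁ₙ Iⁿ tⁿ` by the ideal generated by `I` in degree zero. -/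
def GradedOfIdeal {B : Type u} [CommRing B] (I : Ideal B) : Type u :=
  reesAlgebra I ⧸ I.map (algebraMap B (reesAlgebra I))

instance {B : Type u} [CommRing B] (I : Ideal B) : CommRing (GradedOfIdeal I) :=
  inferInstanceAs (CommRing (reesAlgebra I ⧸ I.map (algebraMap B (reesAlgebra I))))

instance {A B : Type u} [CommRing A] [CommRing B] [Algebra A B] (I : Ideal B) :
    Algebra A (GradedOfIdeal I) :=
  inferInstanceAs (Algebra A (reesAlgebra I ⧸ I.map (algebraMap B (reesAlgebra I))))

instance {A B : Type u} [CommRing A] [CommRing B] [Algebra A B] (I : Ideal B) :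
    IsScalarTower A B (GradedOfIdeal I) :=
  inferInstanceAs (IsScalarTower A B (reesAlgebra I ⧸ I.map (algebraMap B (reesAlgebra I))))

/-- The map `I → ⨁ₙ Iⁿ / Iⁿ⁺¹` sending `x` to the class of `x t`, of degree one. -/
def idealToGraded {B : Type u} [CommRing B] (I : Ideal B) : I →ₗ[B] GradedOfIdeal I :=
  (Ideal.Quotient.mkₐ B (I.map (algebraMap B (reesAlgebra I)))).toLinearMap.comp
    (LinearMap.codRestrict (Subalgebra.toSubmodule (reesAlgebra I))
      ((Polynomial.monomial 1).comp I.subtype)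
      fun x => reesAlgebra.monomial_mem.2 (by simp))

theorem smul_top_le_ker_idealToGraded {B : Type u} [CommRing B] (I : Ideal B) :
    I • (⊤ : Submodule B I) ≤ LinearMap.ker (idealToGraded I) := by
  rw [Submodule.smul_le]
  rintro r hr n -
  rw [LinearMap.mem_ker, LinearMap.map_smul, Algebra.smul_def]
  have : algebraMap B (GradedOfIdeal I) r = 0 :=
    Ideal.Quotient.eq_zero_iff_mem.2 (Ideal.mem_map_of_mem _ hr)
  rw [this, zero_mul]

variable (R A : Type u) [CommRing R] [CommRing A] [Algebra R A]

/-- The canonical map from `Ω_{A/R} = I / I²` to the degree one part of `⨁ₙ Iⁿ / Iⁿ⁺¹`, where `I` is the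
kernel of the multiplication `A ⊗[R] A → A`.  It is linear over `A`, acting through the left factor. -/
def kaehlerToGraded :
    Ω[A⁄R] →ₗ[A] GradedOfIdeal (KaehlerDifferential.ideal R A) :=
  LinearMap.restrictScalars (S := A ⊗[R] A) A
    (show Ω[A⁄R] →ₗ[A ⊗[R] A] GradedOfIdeal (KaehlerDifferential.ideal R A) from
      Submodule.liftQ _ (idealToGraded (KaehlerDifferential.ideal R A))
        (smul_top_le_ker_idealToGraded _))

/-- `A` is differentially smooth over `R`: the module `Ω_{A/R} = I / I²` is finite projective and
the canonical map `Sym_A (I / I²) → ⨁ₙ Iⁿ / Iⁿ⁺¹` is bijective. -/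
structure IsDifferentiallySmoothAlgebra : Prop where
  finite : Module.Finite A Ω[A⁄R]
  projective : Module.Projective A Ω[A⁄R]
  bijective : IsSymmetricAlgebra (kaehlerToGraded R A)

end Ring

/-- A morphism of schemes `f : X ⟶ S` is differentially smooth if `Ω¹_{X/S}` is locally free of finite
rank and `Sym Ω¹_{X/S} → ⨁ₙ Iⁿ / Iⁿ⁺¹` is an isomorphism, where `I` is the ideal of the diagonal.
Both conditions are local on `X`, and are expressed here on affine charts. -/
def IsDifferentiallySmooth {X S : Scheme.{u}} (f : X ⟶ S) : Prop :=
  ∀ x : X, ∃ (V : S.Opens) (U : X.Opens) (e : U ≤ f ⁻¹ᵁ V),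
    IsAffineOpen V ∧ IsAffineOpen U ∧ x ∈ U ∧
      letI := (f.appLE V U e).hom.toAlgebra
      IsDifferentiallySmoothAlgebra Γ(S, V) Γ(X, U)

/-! ### Locally free sheaves of finite rank and their Grothendieck group -/

/-- Every point has an open neighbourhood `U` with `M|_U ≅ 𝒪_U ^ n` for some natural number `n`. -/
def IsLocallyFreeOfFiniteRank {X : Scheme.{u}} (M : X.Modules) : Prop :=
  ∀ x : X, ∃ (U : X.Opens) (n : ℕ), x ∈ U ∧
    Nonempty (M.restrict U.ι ≅
      (SheafOfModules.free (ULift.{u} (Fin n)) : SheafOfModules U.toScheme.ringCatSheaf))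

/-- Locally free `𝒪_X`-modules of finite rank. -/
abbrev FiniteLocallyFree (X : Scheme.{u}) : Type (u + 1) :=
  { M : X.Modules // IsLocallyFreeOfFiniteRank M }

/-- The elements `[M] - [M'] - [M'']` for the short exact sequences `0 → M' → M → M'' → 0` of locally
free `𝒪_X`-modules of finite rank. -/
def exactSequenceRelations (X : Scheme.{u}) : Set (FreeAbelianGroup (FiniteLocallyFree X)) :=
  { r | ∃ (T : ShortComplex X.Modules) (_ : T.ShortExact)
      (h₁ : IsLocallyFreeOfFiniteRank T.X₁) (h₂ : IsLocallyFreeOfFiniteRank T.X₂)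
      (h₃ : IsLocallyFreeOfFiniteRank T.X₃),
      r = FreeAbelianGroup.of ⟨T.X₂, h₂⟩ - FreeAbelianGroup.of ⟨T.X₁, h₁⟩ -
        FreeAbelianGroup.of ⟨T.X₃, h₃⟩ }

/-- The Grothendieck group `K(X)` of locally free `𝒪_X`-modules of finite rank. -/
abbrev KGroup (X : Scheme.{u}) : Type (u + 1) :=
  FreeAbelianGroup (FiniteLocallyFree X) ⧸ AddSubgroup.closure (exactSequenceRelations X)

/-- The class `[M]` in `K(X)` of a locally free `𝒪_X`-module `M` of finite rank. -/
def KGroup.mk {X : Scheme.{u}} (M : X.Modules) (hM : IsLocallyFreeOfFiniteRank M) : KGroup X :=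
  QuotientAddGroup.mk (FreeAbelianGroup.of ⟨M, hM⟩)

/-! ### Sheaves of principal parts -/

section PrincipalParts

variable {X S : Scheme.{u}} (f : X ⟶ S) (k : ℕ)

/-- The `k`-th infinitesimal neighbourhood of the diagonal of `X ×_S X`: the diagonal is closed in the
open subscheme `coborderRange` of `X ×_S X` (which is everything if `X / S` is separated), with ideal
sheaf `I` there, and the neighbourhood is the closed subscheme defined by `Iᵏ⁺¹`. -/
def infinitesimalNbhd : Scheme.{u} :=
  ((Limits.pullback.diagonal f).liftCoborder.ker ^ (k + 1)).subscheme

/-- The immersion of the `k`-th infinitesimal neighbourhood of the diagonal into `X ×_S X`. -/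
def infinitesimalNbhd.ι : infinitesimalNbhd f k ⟶ Limits.pullback f f :=
  ((Limits.pullback.diagonal f).liftCoborder.ker ^ (k + 1)).subschemeι ≫
    (Limits.pullback.diagonal f).coborderRange.ι

/-- The first projection to `X`. -/
def infinitesimalNbhd.fst : infinitesimalNbhd f k ⟶ X :=
  infinitesimalNbhd.ι f k ≫ Limits.pullback.fst f f

/-- The second projection to `X`. -/
def infinitesimalNbhd.snd : infinitesimalNbhd f k ⟶ X :=
  infinitesimalNbhd.ι f k ≫ Limits.pullback.snd f f

/-- The two projections of the infinitesimal neighbourhood coincide on points, so that direct images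
along them have the same underlying sheaf of abelian groups. -/
theorem infinitesimalNbhd.fst_apply_eq_snd_apply (z : infinitesimalNbhd f k) :
    infinitesimalNbhd.fst f k z = infinitesimalNbhd.snd f k z := by
  set d := Limits.pullback.diagonal f
  have hz : (d.liftCoborder.ker ^ (k + 1)).subschemeι z ∈ Set.range d.liftCoborder := by
    have h1 : (d.liftCoborder.ker ^ (k + 1)).subschemeι z ∈
        Set.range (d.liftCoborder.ker ^ (k + 1)).subschemeι := ⟨z, rfl⟩
    rw [Scheme.IdealSheafData.range_subschemeι,
      Scheme.IdealSheafData.support_pow _ _ (Nat.succ_ne_zero k), Scheme.Hom.support_ker] at h1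
    rwa [d.liftCoborder.isClosedEmbedding.isClosed_range.closure_eq] at h1
  obtain ⟨x, hx⟩ := hz
  have hι : infinitesimalNbhd.ι f k z = d x := by
    refine (Scheme.Hom.comp_apply (d.liftCoborder.ker ^ (k + 1)).subschemeι d.coborderRange.ι z).trans ?_
    rw [← hx, ← Scheme.Hom.comp_apply, Scheme.Hom.liftCoborder_ι]
  rw [infinitesimalNbhd.fst, infinitesimalNbhd.snd,Scheme.Hom.comp_apply, Scheme.Hom.comp_apply, hι, ← Scheme.Hom.comp_apply,
    ← Scheme.Hom.comp_apply, Limits.pullback.diagonal_fst, Limits.pullback.diagonal_snd]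

/-- `Jᵏ(E)` with its left `𝒪_X`-module structure, `p_* q^* E` for the projections `p`, `q` of the `k`-th
infinitesimal neighbourhood of the diagonal. -/
def jetLeft (E : X.Modules) : X.Modules :=
  (Scheme.Modules.pushforward (infinitesimalNbhd.fst f k)).obj
    ((Scheme.Modules.pullback (infinitesimalNbhd.snd f k)).obj E)

/-- `Jᵏ(E)` with its right `𝒪_X`-module structure: the same sheaf of abelian groups as `jetLeft`, on
which `𝒪_X` acts through the second projection `q` instead of the first. -/
def jetRight (E : X.Modules) : X.Modules :=
  (Scheme.Modules.pushforward (infinitesimalNbhd.snd f k)).obj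
    ((Scheme.Modules.pullback (infinitesimalNbhd.snd f k)).obj E)

end PrincipalParts

end

/-! Write `J^k` for the principal parts of order `k` of `E` on the neighbourhood `X^(k)`, and
compare consecutive orders. Restriction along `X^(k) → X^(k+1)` is a surjection `J^(k+1) → J^k`,
linear for both structures. Its kernel consists of combinations of local basis sections with
coefficients in `I^(k+1) / I^(k+2)`. For a function `a` on `X`, the difference `p^* a - q^* a` lies
in `I`, so it kills these coefficients: left and right structures agree on the kernel. Hence one
module `K` satisfies `[J^(k+1)] = [K] + [J^k]` on both sides, and the theorem follows by induction
from order `0`, where `p = q`. These steps are `exists_fst_mul_eq_snd_mul`,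
`nonempty_pushforward_iso`, `exists_shortExact` and `mk_pushforward_pullback_eq`.

Differential smoothness supplies local freeness. With `B = A ⊗[R] A`, the graded ring of `I` is a
symmetric algebra on a projective module, hence projective, and each `I^n / I^(n+1)` is a direct
summand of it. It is also finite, so successive extensions make `B / I^n` finite projective for
either `A`-structure (`quotient_pow`). On affine charts this says that `p_* 𝒪` and `q_* 𝒪` are
locally free of finite rank; multiplying a local basis of such a module by a local basis of `q^* E`
gives local bases of the principal parts.

Sheaf arguments are carried out with explicit bases of sections (`IsBasisOn`); the part of
quasi-coherence that is needed is isolated in `LocalizesOn`. -/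

noncomputable section

/-! ### Graded pieces `I^n / I^(n+1)` of an ideal. -/

section GradedPieces

variable {B : Type u} [CommRing B] (I : Ideal B)

/-- The graded piece `Iⁿ / Iⁿ⁺¹` of the associated graded ring of `I`. -/
abbrev GradedPiece (n : ℕ) : Type u :=
  ↥(I ^ n) ⧸ (I • ⊤ : Submodule B ↥(I ^ n))

/-- The map `Iⁿ → ⨁ₙ Iⁿ / Iⁿ⁺¹` sending `x` to the class of `x tⁿ`. -/
def powToGraded (n : ℕ) : ↥(I ^ n) →ₗ[B] GradedOfIdeal I :=
  (Ideal.Quotient.mkₐ B (I.map (algebraMap B (reesAlgebra I)))).toLinearMap.comp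
    (LinearMap.codRestrict (Subalgebra.toSubmodule (reesAlgebra I))
      ((Polynomial.monomial n).comp (I ^ n).subtype)
      fun x => reesAlgebra.monomial_mem.2 (by simp))

theorem smul_top_le_ker_powToGraded (n : ℕ) :
    I • (⊤ : Submodule B ↥(I ^ n)) ≤ LinearMap.ker (powToGraded I n) := by
  rw [Submodule.smul_le]
  rintro r hr n -
  rw [LinearMap.mem_ker, LinearMap.map_smul, Algebra.smul_def]
  have : algebraMap B (GradedOfIdeal I) r = 0 :=
    Ideal.Quotient.eq_zero_iff_mem.2 (Ideal.mem_map_of_mem _ hr)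
  rw [this, zero_mul]

/-- The inclusion of a graded piece into the associated graded ring. -/
def gradedPieceIncl (n : ℕ) : GradedPiece I n →ₗ[B] GradedOfIdeal I :=
  Submodule.liftQ _ (powToGraded I n) (smul_top_le_ker_powToGraded I n)

/-- The coefficient of `tⁿ` in the Rees algebra, as a class in `Iⁿ / Iⁿ⁺¹`. -/
def reesCoeff (n : ℕ) : reesAlgebra I →ₗ[B] GradedPiece I n :=
  (Submodule.mkQ _).comp
    (LinearMap.codRestrict (I ^ n)
      ((Polynomial.lcoeff B n).comp (Subalgebra.toSubmodule (reesAlgebra I)).subtype)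
      fun x => x.2 n)

/-- The projection of the associated graded ring to a graded piece. -/
def gradedPieceProj (n : ℕ) : GradedOfIdeal I →ₗ[B] GradedPiece I n :=
  Submodule.liftQ ((I.map (algebraMap B (reesAlgebra I))).restrictScalars B) (reesCoeff I n) (by
    rw [← Ideal.smul_top_eq_map, Submodule.smul_le]
    rintro r hr x -
    rw [LinearMap.mem_ker, LinearMap.map_smul]
    exact Submodule.Quotient.mk_eq_zero _ |>.2 (Submodule.smul_mem_smul hr trivial))

/-- This exhibits each graded piece as a direct summand of the graded ring, so that projectivity
descends to it without comparing the grading with that of the symmetric algebra. -/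
theorem gradedPieceProj_comp_incl (n : ℕ) :
    (gradedPieceProj I n).comp (gradedPieceIncl I n) = LinearMap.id := by
  apply Submodule.linearMap_qext
  ext x : 1
  refine congrArg (Submodule.mkQ _) (Subtype.ext ?_)
  change (Polynomial.monomial n (x : B)).coeff n = x
  simp

/-- The map `Iⁿ / Iⁿ⁺¹ → B / Iⁿ⁺¹`. -/
def gradedPieceToQuotient (n : ℕ) : GradedPiece I n →ₗ[B] B ⧸ I ^ (n + 1) :=
  Submodule.liftQ _ ((Submodule.mkQ (I ^ (n + 1))).comp (I ^ n).subtype) (by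
    rw [Submodule.smul_le]
    rintro r hr x -
    rw [LinearMap.mem_ker]
    refine (Submodule.Quotient.mk_eq_zero _).2 ?_
    rw [pow_succ']
    exact Ideal.mul_mem_mul hr x.2)

theorem gradedPieceToQuotient_injective (n : ℕ) :
    Function.Injective (gradedPieceToQuotient I n) := by
  rw [← LinearMap.ker_eq_bot, gradedPieceToQuotient, Submodule.ker_liftQ_eq_bot']
  rw [LinearMap.ker_comp, Submodule.ker_mkQ]
  apply Submodule.map_injective_of_injective (I ^ n).injective_subtype
  rw [Submodule.map_comap_subtype, Submodule.map_smul'', Submodule.map_top, Submodule.range_subtype,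
    smul_eq_mul, ← pow_succ', eq_comm, inf_eq_right]
  exact Ideal.pow_le_pow_right n.le_succ

theorem exact_gradedPieceToQuotient (n : ℕ) :
    Function.Exact (gradedPieceToQuotient I n)
      (Submodule.factor (Ideal.pow_le_pow_right n.le_succ : I ^ (n + 1) ≤ I ^ n)) := by
  intro y
  obtain ⟨b, rfl⟩ := Submodule.Quotient.mk_surjective _ y
  constructor
  · intro h
    have hb : b ∈ I ^ n := (Submodule.Quotient.mk_eq_zero _).1 h
    exact ⟨Submodule.Quotient.mk ⟨b, hb⟩, rfl⟩
  · rintro ⟨x, hx⟩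
    obtain ⟨x, rfl⟩ := Submodule.Quotient.mk_surjective _ x
    rw [← hx]
    exact (Submodule.Quotient.mk_eq_zero _).2 x.2

/-- Products of generators of `I` modulo `I^2` generate `I^n` modulo `I^(n+1)`: when `J^n + I^(n+1)`
is multiplied by `J + I^2`, every term except `J^(n+1)` has order at least `n + 2` in `I`. -/
theorem Ideal.pow_le_sup_pow_succ {I J : Ideal B} (h : I ≤ J ⊔ I ^ 2) (hJ : J ≤ I) (n : ℕ) :
    I ^ n ≤ J ^ n ⊔ I ^ (n + 1) := by
  induction n with
  | zero => simp
  | succ n ih =>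
    calc I ^ (n + 1) = I ^ n * I := pow_succ _ _
      _ ≤ (J ^ n ⊔ I ^ (n + 1)) * (J ⊔ I ^ 2) := Ideal.mul_mono ih h
      _ ≤ J ^ (n + 1) ⊔ I ^ (n + 1 + 1) := by
        rw [Ideal.sup_mul, Ideal.mul_sup, Ideal.mul_sup, ← pow_succ, ← pow_add]
        refine sup_le (sup_le le_sup_left ?_) (sup_le ?_ ?_)
        · refine le_sup_of_le_right (le_trans (Ideal.mul_mono_left (Ideal.pow_right_mono hJ n)) ?_)
          rw [← pow_add]
        · refine le_sup_of_le_right ?_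
          rw [pow_succ I (n + 1)]
          exact Ideal.mul_mono_right hJ
        · exact le_sup_of_le_right (Ideal.pow_le_pow_right (by omega))

/-- Only `I / I^2` is assumed finite, not `I`. Lifts of its generators span a finitely generated `J
≤ I` with `I ≤ J + I^2`, and then `J^n` surjects onto `I^n / I^(n+1)`. -/
theorem finite_gradedPiece [Module.Finite B I.Cotangent] (n : ℕ) :
    Module.Finite B (GradedPiece I n) := by
  obtain ⟨s, hs⟩ := (inferInstance : Module.Finite B I.Cotangent).fg_top
  choose g hg using I.toCotangent_surjective
  let J : Ideal B := Ideal.span ((fun x => (g x : B)) '' (s : Set I.Cotangent))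
  have hJ : J ≤ I := Ideal.span_le.2 (by rintro _ ⟨x, -, rfl⟩; exact (g x).2)
  have hJfg : J.FG := (Submodule.fg_span (s.finite_toSet.image _))
  have hIJ : I ≤ J ⊔ I ^ 2 := by
    intro a ha
    have h1 : I.toCotangent ⟨a, ha⟩ ∈ Submodule.span B (s : Set I.Cotangent) := hs ▸ trivial
    have h2 : (s : Set I.Cotangent) = I.toCotangent '' (g '' (s : Set I.Cotangent)) := by
      rw [Set.image_image]; simp [hg]
    rw [h2, ← Submodule.map_span] at h1
    obtain ⟨b, hb, hba⟩ := h1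
    rw [I.toCotangent_eq] at hba
    have hbJ : (b : B) ∈ J := by
      have := Submodule.mem_map_of_mem (f := I.subtype) hb
      rw [Submodule.map_span, Set.image_image] at this
      exact this
    have : a = b - (b - a) := by ring
    rw [this]
    exact sub_mem (Ideal.mem_sup_left hbJ) (Ideal.mem_sup_right hba)
  have : Module.Finite B ↥(J ^ n) := Module.Finite.iff_fg.2 (hJfg.pow (n := n))
  refine Module.Finite.of_surjective
    ((Submodule.mkQ _).comp (Submodule.inclusion (Ideal.pow_right_mono hJ n)) :
      ↥(J ^ n) →ₗ[B] GradedPiece I n) ?_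
  intro y
  obtain ⟨⟨y, hy⟩, rfl⟩ := Submodule.Quotient.mk_surjective _ y
  obtain ⟨a, ha, b, hb, hab⟩ := Submodule.mem_sup.1 (Ideal.pow_le_sup_pow_succ hIJ hJ n hy)
  refine ⟨⟨a, ha⟩, (Submodule.Quotient.eq _).2 ?_⟩
  have : Submodule.map (I ^ n).subtype (I • ⊤ : Submodule B ↥(I ^ n)) = I ^ (n + 1) := by
    rw [Submodule.map_smul'', Submodule.map_top, Submodule.range_subtype, smul_eq_mul, ← pow_succ']
  rw [← this] at hb
  obtain ⟨c, hc, rfl⟩ := hb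
  convert neg_mem hc
  ext
  simp [← hab]

end GradedPieces

/-! ### Finite projectivity along a ring homomorphism. -/

section FiniteProjectiveAlong

variable {A B C : Type*} [CommRing A] [CommRing B] [CommRing C]

/-- The `B`-module `M` is finite and projective over `A`, which acts through `φ : A → B`. -/
def FiniteProjectiveAlong (φ : A →+* B) (M : Type*) [AddCommGroup M] [Module B M] : Prop :=
  letI := Module.compHom M φ
  Module.Finite A M ∧ Module.Projective A M

namespace FiniteProjectiveAlong

theorem of_equiv {φ : A →+* B} {ψ : A →+* C} {M N : Type*} [AddCommGroup M] [Module B M]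
    [AddCommGroup N] [Module C N] (e : M ≃+ N) (he : ∀ a m, e (φ a • m) = ψ a • e m)
    (h : FiniteProjectiveAlong φ M) : FiniteProjectiveAlong ψ N := by
  let _ := Module.compHom M φ
  let _ := Module.compHom N ψ
  obtain ⟨h1, h2⟩ := h
  let e' : M ≃ₗ[A] N := { e with map_smul' := he }
  exact ⟨Module.Finite.equiv e', Module.Projective.of_equiv' e'⟩

/-- Over `A` the sequence splits because `P` is projective there, so `N` is `M × P` as an
`A`-module; no splitting over `B` is needed. -/
theorem of_exact {φ : A →+* B} {M N P : Type*} [AddCommGroup M] [Module B M]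
    [AddCommGroup N] [Module B N] [AddCommGroup P] [Module B P] (f : M →ₗ[B] N) (g : N →ₗ[B] P)
    (hf : Function.Injective f) (hfg : Function.Exact f g) (hg : Function.Surjective g)
    (hM : FiniteProjectiveAlong φ M) (hP : FiniteProjectiveAlong φ P) :
    FiniteProjectiveAlong φ N := by
  let _ := Module.compHom M φ
  let _ := Module.compHom N φ
  let _ := Module.compHom P φ
  obtain ⟨h1, h2⟩ := hM
  obtain ⟨h3, h4⟩ := hP
  let f' : M →ₗ[A] N := { f with map_smul' := fun a m => f.map_smul (φ a) m }
  let g' : N →ₗ[A] P := { g with map_smul' := fun a m => g.map_smul (φ a) m }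
  have hfg' : Function.Exact f' g' := hfg
  obtain ⟨l, hl⟩ := Module.projective_lifting_property g' LinearMap.id hg
  obtain ⟨e, -⟩ : ∃ e : N ≃ₗ[A] M × P, f' = e.symm ∘ₗ LinearMap.inl A M P ∧
      g' = LinearMap.snd A M P ∘ₗ e :=
    (hfg'.split_tfae'.out 0 2).1
      (show Function.Injective f' ∧ ∃ l, g' ∘ₗ l = LinearMap.id from ⟨hf, l, hl⟩)
  exact ⟨Module.Finite.equiv e.symm, Module.Projective.of_equiv' e.symm⟩

theorem quotient_pow {A B : Type u} [CommRing A] [CommRing B] (I : Ideal B) {φ : A →+* B}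
    (h : ∀ n, FiniteProjectiveAlong φ (GradedPiece I n)) (n : ℕ) :
    FiniteProjectiveAlong φ (B ⧸ I ^ n) := by
  induction n with
  | zero =>
    let _ := Module.compHom (B ⧸ I ^ 0) φ
    have : Subsingleton (B ⧸ I ^ 0) := Ideal.Quotient.subsingleton_iff.2 (by simp)
    exact ⟨inferInstance, inferInstance⟩
  | succ n ih =>
    refine of_exact (gradedPieceToQuotient I n) _ (gradedPieceToQuotient_injective I n)
      (exact_gradedPieceToQuotient I n) ?_ (h n) ih
    exact Submodule.factor_surjective _

end FiniteProjectiveAlong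

/-- Since `B` acts through `B / I`, onto which `A` surjects, every `A`-span is stable under `B`;
generators over `B` therefore generate over `A`. -/
theorem finite_of_surjective_quotient [Algebra A B] (I : Ideal B) {M : Type*} [AddCommGroup M]
    [Module B M] [Module A M] [IsScalarTower A B M] [Module.Finite B M]
    (hI : ∀ b ∈ I, ∀ m : M, b • m = 0) (h : ∀ b : B, ∃ a : A, b - algebraMap A B a ∈ I) :
    Module.Finite A M := by
  obtain ⟨s, hs⟩ := (inferInstance : Module.Finite B M).fg_top
  refine ⟨⟨s, ?_⟩⟩
  let N : Submodule B M :=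
    { Submodule.span A (s : Set M) with
      smul_mem' := fun b x hx => by
        obtain ⟨a, ha⟩ := h b
        have : b • x = a • x := by
          rw [← sub_eq_zero, ← algebraMap_smul B a x, ← sub_smul, hI _ ha]
        change b • x ∈ Submodule.span A (s : Set M)
        rw [this]
        exact Submodule.smul_mem _ _ hx }
  have : (⊤ : Submodule B M) ≤ N := hs ▸ Submodule.span_le.2 Submodule.subset_span
  exact eq_top_iff.2 fun x _ => this trivial

end FiniteProjectiveAlong

/-! ### Finite projectivity of `(A ⊗[R] A) / I^n` for differentially smooth algebras. -/

section SymmetricAlgebra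

/-- A retraction of a free module onto `M` induces a retraction of symmetric algebras, and the
symmetric algebra of a free module is free, being a polynomial ring. -/
theorem SymmetricAlgebra.projective (R M : Type*) [CommRing R] [AddCommGroup M] [Module R M]
    [Module.Projective R M] : Module.Projective R (SymmetricAlgebra R M) := by
  obtain ⟨s, hs⟩ := Module.projective_def'.1 (inferInstance : Module.Projective R M)
  let p : (M →₀ R) →ₗ[R] M := Finsupp.linearCombination R id
  let i : SymmetricAlgebra R M →ₐ[R] SymmetricAlgebra R (M →₀ R) :=
    SymmetricAlgebra.lift ((SymmetricAlgebra.ι R _).comp s)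
  let r : SymmetricAlgebra R (M →₀ R) →ₐ[R] SymmetricAlgebra R M :=
    SymmetricAlgebra.lift ((SymmetricAlgebra.ι R _).comp p)
  have : r.comp i = AlgHom.id R _ := by
    apply SymmetricAlgebra.algHom_ext
    ext m
    have : p (s m) = m := LinearMap.congr_fun hs m
    simp [i, r, this]
  exact Module.Projective.of_split i.toLinearMap r.toLinearMap
    (LinearMap.ext fun x => AlgHom.congr_fun this x)

variable {R A : Type u} [CommRing R] [CommRing A] [Algebra R A]

namespace IsDifferentiallySmoothAlgebra

variable (h : IsDifferentiallySmoothAlgebra R A)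
include h

theorem projective_graded :
    Module.Projective A (GradedOfIdeal (KaehlerDifferential.ideal R A)) := by
  have := h.projective
  have := SymmetricAlgebra.projective A Ω[A⁄R]
  exact Module.Projective.of_equiv' h.bijective.equiv.toLinearEquiv

theorem finiteProjectiveAlong_gradedPiece_left (n : ℕ) :
    FiniteProjectiveAlong (Algebra.TensorProduct.includeLeftRingHom : A →+* A ⊗[R] A)
      (GradedPiece (KaehlerDifferential.ideal R A) n) := by
  set I := KaehlerDifferential.ideal R A
  have := h.projective_graded
  have hf : Module.Finite A I.Cotangent := h.finite
  have : Module.Finite (A ⊗[R] A) I.Cotangent := Module.Finite.of_restrictScalars_finite A _ _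
  have hp : Module.Projective A (GradedPiece I n) :=
    Module.Projective.of_split ((gradedPieceIncl I n).restrictScalars A)
      ((gradedPieceProj I n).restrictScalars A)
      (LinearMap.ext fun x => LinearMap.congr_fun (gradedPieceProj_comp_incl I n) x)
  have := finite_gradedPiece I n
  have hfin : Module.Finite A (GradedPiece I n) := by
    refine finite_of_surjective_quotient (B := A ⊗[R] A) I ?_ fun b => ?_
    · intro b hb m
      obtain ⟨m, rfl⟩ := Submodule.Quotient.mk_surjective _ m
      exact (Submodule.Quotient.mk_eq_zero _).2 (Submodule.smul_mem_smul hb trivial)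
    · refine ⟨Algebra.TensorProduct.lmul' R b, ?_⟩
      simp [I, KaehlerDifferential.ideal, RingHom.mem_ker]
  have hm : Module.compHom (GradedPiece I n)
      (Algebra.TensorProduct.includeLeftRingHom : A →+* A ⊗[R] A) =
      (inferInstance : Module A (GradedPiece I n)) := by
    refine Module.ext' _ _ fun a m => ?_
    exact algebraMap_smul (A ⊗[R] A) a m
  rw [FiniteProjectiveAlong, hm]
  exact ⟨hfin, hp⟩

/-- The element `a ⊗ 1 - 1 ⊗ a` lies in `I`, which kills `I^n / I^(n+1)`; the two actions of `A`
coincide there, although they differ on `B / I^n` in general. -/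
theorem finiteProjectiveAlong_gradedPiece_right (n : ℕ) :
    FiniteProjectiveAlong
      ((Algebra.TensorProduct.includeRight : A →ₐ[R] A ⊗[R] A) : A →+* A ⊗[R] A)
      (GradedPiece (KaehlerDifferential.ideal R A) n) := by
  refine (h.finiteProjectiveAlong_gradedPiece_left n).of_equiv (AddEquiv.refl _) fun a m => ?_
  change (a ⊗ₜ[R] (1 : A)) • m = ((1 : A) ⊗ₜ[R] a) • m
  rw [← sub_eq_zero, ← sub_smul]
  obtain ⟨m, rfl⟩ := Submodule.Quotient.mk_surjective _ m
  refine (Submodule.Quotient.mk_eq_zero _).2 (Submodule.smul_mem_smul ?_ trivial)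
  simp [KaehlerDifferential.ideal, RingHom.mem_ker]

theorem finiteProjectiveAlong_quotient_pow_left (n : ℕ) :
    FiniteProjectiveAlong (Algebra.TensorProduct.includeLeftRingHom : A →+* A ⊗[R] A)
      (A ⊗[R] A ⧸ KaehlerDifferential.ideal R A ^ n) :=
  FiniteProjectiveAlong.quotient_pow _ h.finiteProjectiveAlong_gradedPiece_left n

theorem finiteProjectiveAlong_quotient_pow_right (n : ℕ) :
    FiniteProjectiveAlong
      ((Algebra.TensorProduct.includeRight : A →ₐ[R] A ⊗[R] A) : A →+* A ⊗[R] A)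
      (A ⊗[R] A ⧸ KaehlerDifferential.ideal R A ^ n) :=
  FiniteProjectiveAlong.quotient_pow _ h.finiteProjectiveAlong_gradedPiece_right n

end IsDifferentiallySmoothAlgebra

end SymmetricAlgebra

/-! ### Bases of sections and their behaviour under restriction and pullback. -/

namespace AlgebraicGeometry.Scheme.Modules

variable {X Y : Scheme.{u}}

/-- The sections `s i` of `M` over `U` form a basis of `M|_U`: for every `W ≤ U`, every section of `M`
over `W` is a unique linear combination of the `s i|_W`. -/
def IsBasisOn (M : X.Modules) (U : X.Opens) {ι : Type*} [Fintype ι] (s : ι → Γ(M, U)) : Prop :=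
  ∀ (W : X.Opens) (h : W ≤ U), Function.Bijective
    fun c : ι → Γ(X, W) => ∑ i, c i • M.presheaf.map (homOfLE h).op (s i)

theorem map_map_apply (M : X.Modules) {U V W : X.Opens} (h : V ≤ U) (h' : W ≤ V) (s : Γ(M, U)) :
    M.presheaf.map (homOfLE h').op (M.presheaf.map (homOfLE h).op s) =
      M.presheaf.map (homOfLE (h'.trans h)).op s := by
  rw [← ConcreteCategory.comp_apply, ← Functor.map_comp]
  rfl

theorem Hom.app_map {M N : X.Modules} (φ : M ⟶ N) {U V : X.Opens} (h : V ≤ U) (s : Γ(M, U)) :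
    φ.app V (M.presheaf.map (homOfLE h).op s) = N.presheaf.map (homOfLE h).op (φ.app U s) :=
  ConcreteCategory.congr_hom (φ.mapPresheaf.naturality (homOfLE h).op) s

variable {ι : Type*} [Fintype ι]

theorem Hom.app_sum_smul {M N : X.Modules} (φ : M ⟶ N) {U V : X.Opens} (h : V ≤ U)
    (s : ι → Γ(M, U)) (c : ι → Γ(X, V)) :
    φ.app V (∑ i, c i • M.presheaf.map (homOfLE h).op (s i)) =
      ∑ i, c i • N.presheaf.map (homOfLE h).op (φ.app U (s i)) := by
  simp_rw [map_sum, Hom.app_smul, Hom.app_map]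

theorem Hom.sum_app_apply {M N : X.Modules} {κ : Type*} (t : Finset κ) (φ : κ → (M ⟶ N))
    (U : X.Opens) (m : Γ(M, U)) : (∑ k ∈ t, φ k).app U m = ∑ k ∈ t, (φ k).app U m :=
  map_sum (AddMonoidHom.mk' (fun ψ : M ⟶ N => ψ.app U m) fun _ _ => rfl) φ t

namespace IsBasisOn

theorem restrict {M : X.Modules} {U : X.Opens} {s : ι → Γ(M, U)} (hs : IsBasisOn M U s)
    {V : X.Opens} (h : V ≤ U) : IsBasisOn M V fun i => M.presheaf.map (homOfLE h).op (s i) := by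
  intro W hW
  simp_rw [map_map_apply]
  exact hs W (hW.trans h)

theorem map_iff {M N : X.Modules} (φ : M ⟶ N) {U : X.Opens}
    (hφ : ∀ W ≤ U, Function.Bijective (φ.app W)) (s : ι → Γ(M, U)) :
    IsBasisOn N U (fun i => φ.app U (s i)) ↔ IsBasisOn M U s := by
  refine forall₂_congr fun W hW => ?_
  simp_rw [← φ.app_sum_smul]
  exact (hφ W hW).of_comp_iff' _

theorem reindex {M : X.Modules} {U : X.Opens} {s : ι → Γ(M, U)} (hs : IsBasisOn M U s)
    {κ : Type*} [Fintype κ] (e : κ ≃ ι) : IsBasisOn M U (s ∘ e) := by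
  intro W hW
  have : (fun c : κ → Γ(X, W) => ∑ k, c k • M.presheaf.map (homOfLE hW).op ((s ∘ e) k)) =
      (fun c : ι → Γ(X, W) => ∑ i, c i • M.presheaf.map (homOfLE hW).op (s i)) ∘
        (fun c => c ∘ e.symm) := by
    funext c
    simp only [Function.comp]
    rw [← e.sum_comp]
    simp
  rw [this]
  exact (hs W hW).comp (e.arrowCongr (Equiv.refl _)).bijective

/-- A morphism that maps a basis to a basis is bijective on sections. -/
theorem bijective_app {M N : X.Modules} (φ : M ⟶ N) {U : X.Opens} {s : ι → Γ(M, U)}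
    (hs : IsBasisOn M U s) (hφs : IsBasisOn N U (fun i => φ.app U (s i)))
    {W : X.Opens} (hW : W ≤ U) : Function.Bijective (φ.app W) := by
  have := hφs W hW
  simp_rw [← φ.app_sum_smul] at this
  exact (Function.Bijective.of_comp_iff _ (hs W hW)).1 this

end IsBasisOn

theorem isIso_of_bijective {M N : X.Modules} (φ : M ⟶ N)
    (h : ∀ W, Function.Bijective (φ.app W)) : IsIso φ :=
  Hom.isIso_iff_isIso_app.2 fun W => (ConcreteCategory.isIso_iff_bijective _).2 (h W)

theorem bijective_app_of_isIso {M N : X.Modules} (φ : M ⟶ N) [IsIso φ] (W : X.Opens) :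
    Function.Bijective (φ.app W) :=
  (ConcreteCategory.isIso_iff_bijective _).1 inferInstance

/-- The structure sheaf as a module over itself. -/
abbrev unit (X : Scheme.{u}) : X.Modules := SheafOfModules.unit X.ringCatSheaf

/-- The free module on a type. -/
abbrev free (X : Scheme.{u}) (I : Type u) : X.Modules :=
  (SheafOfModules.free I : SheafOfModules X.ringCatSheaf)

/-- Families of global sections correspond to compatible families of sections. -/
def sectionsEquiv (M : X.Modules) : (SheafOfModules.sections M) ≃ Γ(M, (⊤ : X.Opens)) where
  toFun s := s.val (.op ⊤)
  invFun s := ⟨fun U => M.presheaf.map (homOfLE (le_top : U.unop ≤ ⊤)).op s, fun {U V} f => by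
    exact map_map_apply M le_top f.unop.le s⟩
  left_inv s := by
    ext U
    exact s.property (homOfLE (le_top : U.unop ≤ ⊤)).op
  right_inv s := by
    change M.presheaf.map (𝟙 _) s = s
    simp

/-- Morphisms from a free module are families of global sections. -/
def freeEquiv (M : X.Modules) (I : Type u) : (free X I ⟶ M) ≃ (I → Γ(M, (⊤ : X.Opens))) :=
  (SheafOfModules.freeHomEquiv M).trans (Equiv.piCongrRight fun _ => sectionsEquiv M)

/-- The standard sections of a free module. -/
def freeBasis (X : Scheme.{u}) (I : Type u) : I → Γ(free X I, (⊤ : X.Opens)) :=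
  freeEquiv _ I (𝟙 _)

theorem freeEquiv_apply {M : X.Modules} {I : Type u} (φ : free X I ⟶ M) (i : I) :
    freeEquiv M I φ i = φ.app ⊤ (freeBasis X I i) := rfl

theorem freeEquiv_comp {M N : X.Modules} {I : Type u} (φ : free X I ⟶ M) (ψ : M ⟶ N) (i : I) :
    freeEquiv N I (φ ≫ ψ) i = ψ.app ⊤ (freeEquiv M I φ i) := rfl

/-- A finite coproduct is a biproduct. The coordinate maps `π` act on sections over every open set
and recover the coefficients, so the coproduct need not be computed as a sheaf. -/
theorem isBasisOn_freeBasis (X : Scheme.{u}) (I : Type u) [Fintype I] :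
    IsBasisOn (free X I) ⊤ (freeBasis X I) := by
  classical
  let inj (i : I) : unit X ⟶ free X I := SheafOfModules.ιFree i
  let π (j : I) : free X I ⟶ unit X :=
    Limits.Cofan.IsColimit.desc (SheafOfModules.isColimitFreeCofan I)
      (fun i => if i = j then 𝟙 (SheafOfModules.unit X.ringCatSheaf) else 0)
  have hπ (i j : I) : inj i ≫ π j = if i = j then 𝟙 _ else 0 :=
    Limits.Cofan.IsColimit.fac (SheafOfModules.isColimitFreeCofan I) _ i
  have hid : ∑ i, π i ≫ inj i = 𝟙 (free X I) := by
    refine Limits.Cofan.IsColimit.hom_ext (SheafOfModules.isColimitFreeCofan I) _ _ fun j => ?_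
    change inj j ≫ _ = inj j ≫ 𝟙 _
    rw [Preadditive.comp_sum, Finset.sum_eq_single j]
    · rw [← Category.assoc, hπ]; simp
    · intro i _ hi
      rw [← Category.assoc, hπ, if_neg hi.symm]; simp
    · simp
  intro W hW
  have hinj (i : I) (c : Γ(X, W)) : c • (free X I).presheaf.map (homOfLE hW).op (freeBasis X I i) =
      (inj i).app W (show Γ(unit X, W) from c) := by
    have h1 : freeBasis X I i = (inj i).app ⊤ (show Γ(unit X, ⊤) from (1 : Γ(X, ⊤))) := rfl
    rw [h1, ← Hom.app_map, ← Hom.app_smul]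
    congr 1
    change c * X.presheaf.map (homOfLE hW).op 1 = c
    rw [map_one, mul_one]
  simp_rw [hinj]
  have h1 (c : I → Γ(X, W)) (j : I) :
      (π j).app W (∑ i, (inj i).app W (show Γ(unit X, W) from c i)) = c j := by
    rw [map_sum, Finset.sum_eq_single j]
    · rw [← ConcreteCategory.comp_apply, ← Hom.comp_app, hπ, if_pos rfl]; rfl
    · intro i _ hi
      rw [← ConcreteCategory.comp_apply, ← Hom.comp_app, hπ, if_neg hi]; rfl
    · simp
  constructor
  · intro c d hcd
    funext j
    rw [← h1 c j, ← h1 d j]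
    exact congrArg _ hcd
  · intro m
    refine ⟨fun i => (π i).app W m, ?_⟩
    have := congrArg (fun φ : free X I ⟶ free X I => φ.app W m) hid
    rw [Hom.sum_app_apply] at this
    exact this

/-- A global basis identifies a module with a free module. -/
theorem IsBasisOn.isIso_freeEquiv_symm {M : X.Modules} {I : Type u} [Fintype I]
    {s : I → Γ(M, (⊤ : X.Opens))} (hs : IsBasisOn M ⊤ s) : IsIso ((freeEquiv M I).symm s) := by
  refine isIso_of_bijective _ fun W => (isBasisOn_freeBasis X I).bijective_app _ ?_ le_top
  convert hs using 2 with i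
  rw [← freeEquiv_apply, Equiv.apply_symm_apply]

theorem isBasisOn_of_isIso {M : X.Modules} {I : Type u} [Fintype I] (φ : free X I ⟶ M) [IsIso φ] :
    IsBasisOn M ⊤ (freeEquiv M I φ) :=
  (IsBasisOn.map_iff φ (fun W _ => bijective_app_of_isIso φ W) _).2 (isBasisOn_freeBasis X I)

theorem IsBasisOn.restrict_of_isOpenImmersion {M : Y.Modules} (j : X ⟶ Y) [IsOpenImmersion j]
    {U : X.Opens} {s : ι → Γ(M.restrict j, U)} :
    IsBasisOn (M.restrict j) U s ↔ IsBasisOn M (j ''ᵁ U) (fun i => (s i : Γ(M, j ''ᵁ U))) := by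
  have key (W : X.Opens) (h : W ≤ U) : (fun c : ι → Γ(X, W) =>
      ∑ i, c i • (M.restrict j).presheaf.map (homOfLE h).op (s i)) =
      (fun c : ι → Γ(Y, j ''ᵁ W) => (show Γ(M, j ''ᵁ W) from
        ∑ i, c i • M.presheaf.map (homOfLE (j.image_mono h)).op (s i : Γ(M, j ''ᵁ U)))) ∘
      (fun c i => (j.appIso W).inv (c i)) := rfl
  have hbij (W : X.Opens) :
      Function.Bijective (fun (c : ι → Γ(X, W)) i => (j.appIso W).inv (c i)) :=
    Function.Bijective.piMap fun _ =>
      (ConcreteCategory.isIso_iff_bijective (j.appIso W).inv).1 inferInstance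
  constructor
  · intro h W' hW'
    obtain ⟨W, rfl⟩ : ∃ W, W' = j ''ᵁ W := ⟨j ⁻¹ᵁ W', by
      rw [Scheme.Hom.image_preimage_eq_opensRange_inf, inf_eq_right.2]
      exact hW'.trans (Scheme.Hom.image_le_opensRange _ _)⟩
    have hW : W ≤ U := (Scheme.Hom.image_le_image_iff j W U).1 hW'
    have := h W hW
    rw [key W hW] at this
    exact (Function.Bijective.of_comp_iff _ (hbij W)).1 this
  · intro h W hW
    rw [key W hW]
    exact (Function.Bijective.of_comp_iff _ (hbij W)).2 (h _ (j.image_mono hW))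

theorem IsBasisOn.restrict_iff {M : X.Modules} {U V : X.Opens} (s : ι → Γ(M, U)) (h : V ≤ U)
    (h' : U ≤ V) : IsBasisOn M V (fun i => M.presheaf.map (homOfLE h).op (s i)) ↔ IsBasisOn M U s := by
  refine ⟨fun hs => ?_, fun hs => hs.restrict h⟩
  obtain rfl := le_antisymm h h'
  convert hs using 2 with i
  exact (ConcreteCategory.congr_hom (M.presheaf.map_id _) (s i)).symm

/-- Local bases of a locally free module. -/
theorem exists_isBasisOn {M : X.Modules} (hM : IsLocallyFreeOfFiniteRank M) (x : X) :
    ∃ (U : X.Opens) (n : ℕ) (s : Fin n → Γ(M, U)), x ∈ U ∧ IsBasisOn M U s := by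
  obtain ⟨U, n, hx, ⟨e⟩⟩ := hM x
  let φ : free U.toScheme (ULift.{u} (Fin n)) ⟶ M.restrict U.ι := e.inv
  have h := (IsBasisOn.restrict_of_isOpenImmersion U.ι).1 (isBasisOn_of_isIso φ)
  have h1 : U ≤ U.ι ''ᵁ ⊤ := by simp
  exact ⟨U, n, _, hx, (h.restrict h1).reindex Equiv.ulift.symm⟩

theorem isLocallyFreeOfFiniteRank_of_isBasisOn {M : X.Modules}
    (h : ∀ x : X, ∃ (U : X.Opens) (κ : Type) (_ : Fintype κ) (s : κ → Γ(M, U)),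
      x ∈ U ∧ IsBasisOn M U s) : IsLocallyFreeOfFiniteRank M := by
  intro x
  obtain ⟨U, κ, _, s, hx, hs⟩ := h x
  refine ⟨U, Fintype.card κ, hx, ?_⟩
  have h1 : U.ι ''ᵁ ⊤ ≤ U := by simp
  have h2 := (IsBasisOn.restrict_of_isOpenImmersion U.ι).2
    ((hs.restrict h1).reindex (Equiv.ulift.{u}.trans (Fintype.equivFin κ).symm))
  have := h2.isIso_freeEquiv_symm
  exact ⟨(@asIso _ _ _ _ _ this).symm⟩

/-! ### Pullbacks -/

/-- The pullback of a section along a morphism of schemes. -/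
def pullbackSection (q : Y ⟶ X) {M : X.Modules} {U : X.Opens} (s : Γ(M, U)) :
    Γ((pullback q).obj M, q ⁻¹ᵁ U) :=
  ((pullbackPushforwardAdjunction q).unit.app M).app U s

theorem pullbackSection_map (q : Y ⟶ X) {M : X.Modules} {U V : X.Opens} (h : V ≤ U)
    (s : Γ(M, U)) : pullbackSection q (M.presheaf.map (homOfLE h).op s) =
      ((pullback q).obj M).presheaf.map (homOfLE (q.preimage_mono h)).op (pullbackSection q s) :=
  Hom.app_map _ h s

theorem pullbackSection_comp {Z : Scheme.{u}} (q : Y ⟶ X) (r : Z ⟶ Y) {M : X.Modules}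
    {U : X.Opens} (s : Γ(M, U)) :
    ((pullbackComp r q).inv.app M).app (r ⁻¹ᵁ q ⁻¹ᵁ U) (pullbackSection (r ≫ q) s) =
      pullbackSection r (pullbackSection q s) := by
  have := conjugateEquiv_pullbackComp_inv r q
  have h2 := unit_conjugateEquiv ((pullbackPushforwardAdjunction q).comp (pullbackPushforwardAdjunction r))
      (pullbackPushforwardAdjunction (r ≫ q)) (pullbackComp r q).inv M
  rw [conjugateEquiv_pullbackComp_inv] at h2
  have h3 := congrArg (fun φ => φ.app U s) h2
  exact h3.symm

theorem pullbackSection_isOpenImmersion (j : X ⟶ Y) [IsOpenImmersion j] {M : Y.Modules}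
    {U : Y.Opens} (s : Γ(M, U)) :
    ((restrictFunctorIsoPullback j).hom.app M).app (j ⁻¹ᵁ U)
      (show Γ(M.restrict j, j ⁻¹ᵁ U) from M.presheaf.map (homOfLE (j.image_preimage_le U)).op s) =
      pullbackSection j s := by
  have h2 := Adjunction.unit_leftAdjointUniq_hom_app (restrictAdjunction j)
    (pullbackPushforwardAdjunction j) M
  exact congrArg (fun φ => φ.app U s) h2

theorem IsBasisOn.pullback_isOpenImmersion_iff (j : X ⟶ Y) [IsOpenImmersion j] {M : Y.Modules}
    {U : Y.Opens} (hU : U ≤ j.opensRange) (s : ι → Γ(M, U)) :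
    IsBasisOn ((pullback j).obj M) (j ⁻¹ᵁ U) (fun i => pullbackSection j (s i)) ↔
      IsBasisOn M U s := by
  have h1 := IsBasisOn.map_iff ((restrictFunctorIsoPullback j).hom.app M)
    (fun W (_ : W ≤ j ⁻¹ᵁ U) => bijective_app_of_isIso _ W)
    (fun i => (show Γ(M.restrict j, j ⁻¹ᵁ U) from
      M.presheaf.map (homOfLE (j.image_preimage_le U)).op (s i)))
  have h2 (i : ι) := pullbackSection_isOpenImmersion j (s i)
  rw [funext h2] at h1
  refine h1.trans ((IsBasisOn.restrict_of_isOpenImmersion j).trans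
    (IsBasisOn.restrict_iff s (j.image_preimage_le U) ?_))
  rw [Scheme.Hom.image_preimage_eq_opensRange_inf]
  exact le_inf hU le_rfl

/-- A Yoneda argument avoids any formula for the sections of a pullback: maps from `q^* M` to `N`
are maps from `M` to `q_* N`, which the basis identifies with families of global sections of `N`,
that is, with maps from a free module to `N`. -/
theorem IsBasisOn.pullback_top (q : Y ⟶ X) {M : X.Modules} {I : Type u} [Fintype I]
    {s : I → Γ(M, (⊤ : X.Opens))} (hs : IsBasisOn M ⊤ s) :
    IsBasisOn ((pullback q).obj M) (q ⁻¹ᵁ ⊤) (fun i => pullbackSection q (s i)) := by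
  let σ := (freeEquiv M I).symm s
  have : IsIso σ := hs.isIso_freeEquiv_symm
  let g : free Y I ⟶ (Modules.pullback q).obj M :=
    (freeEquiv _ I).symm (fun i => pullbackSection q (s i))
  have hg : IsIso g := by
    rw [isIso_iff_coyoneda_map_bijective]
    intro N
    rw [← (freeEquiv N I).bijective.of_comp_iff']
    have : freeEquiv N I ∘ (fun φ : (Modules.pullback q).obj M ⟶ N => g ≫ φ) =
        freeEquiv ((pushforward q).obj N) I ∘ (fun ψ => σ ≫ ψ) ∘
          ((pullbackPushforwardAdjunction q).homEquiv M N) := by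
      funext φ i
      have h1 : freeEquiv N I (g ≫ φ) i = φ.app ⊤ (pullbackSection q (s i)) := by
        rw [freeEquiv_comp]
        exact congrArg (φ.app ⊤) (congrFun ((freeEquiv _ I).apply_symm_apply _) i)
      have h2 (ψ : M ⟶ (pushforward q).obj N) : freeEquiv _ I (σ ≫ ψ) i = ψ.app ⊤ (s i) := by
        rw [freeEquiv_comp, Equiv.apply_symm_apply]
      refine h1.trans (Eq.trans ?_ (h2 _).symm)
      rw [Adjunction.homEquiv_unit]
      rfl
    rw [this]
    exact (Equiv.bijective _).comp (((isIso_iff_coyoneda_map_bijective σ).1 inferInstance _).comp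
      (Equiv.bijective _))
  have h := isBasisOn_of_isIso g
  have hgs : freeEquiv _ I g = fun i => pullbackSection q (s i) :=
    (freeEquiv _ I).apply_symm_apply _
  rw [hgs] at h
  exact h

theorem IsBasisOn.pullback_comp_iff {Z : Scheme.{u}} (q : Y ⟶ X) (r : Z ⟶ Y) {M : X.Modules}
    {U : X.Opens} (s : ι → Γ(M, U)) :
    IsBasisOn ((Modules.pullback r).obj ((Modules.pullback q).obj M)) (r ⁻¹ᵁ q ⁻¹ᵁ U)
      (fun i => pullbackSection r (pullbackSection q (s i))) ↔
    IsBasisOn ((Modules.pullback (r ≫ q)).obj M) ((r ≫ q) ⁻¹ᵁ U)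
      (fun i => pullbackSection (r ≫ q) (s i)) := by
  have h1 := IsBasisOn.map_iff ((pullbackComp r q).inv.app M)
    (fun W (_ : W ≤ r ⁻¹ᵁ q ⁻¹ᵁ U) => bijective_app_of_isIso _ W)
    (fun i => (pullbackSection (r ≫ q) (s i)))
  have h2 (i : ι) := pullbackSection_comp q r (s i)
  rw [funext h2] at h1
  exact h1

theorem IsBasisOn.pullback (q : Y ⟶ X) {M : X.Modules} {U : X.Opens} {I : Type u} [Fintype I]
    {s : I → Γ(M, U)} (hs : IsBasisOn M U s) :
    IsBasisOn ((pullback q).obj M) (q ⁻¹ᵁ U) (fun i => pullbackSection q (s i)) := by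
  have h1 := (pullback_isOpenImmersion_iff U.ι (by simp) s).2 hs
  have h2 : ⊤ ≤ U.ι ⁻¹ᵁ U := by simp
  have h3 := (h1.restrict h2).pullback_top (q ∣_ U)
  simp_rw [pullbackSection_map] at h3
  rw [restrict_iff _ _ (Scheme.Hom.preimage_mono _ le_top)] at h3
  -- The restricted morphism followed by the inclusion of `U` equals the inclusion of the preimage
  -- of `U` followed by `q`; pulling back along both factorizations removes the restriction to `U`.
  rw [pullback_comp_iff, morphismRestrict_ι, ← pullback_comp_iff,
    pullback_isOpenImmersion_iff _ (by simp)] at h3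
  exact h3

end AlgebraicGeometry.Scheme.Modules

/-! ### Bases of finite projective modules away from one element. -/

section LocalFreeness

/-- A finite projective module is free after inverting a single element outside of a given prime. -/
theorem Module.exists_basis_up_to_powers (A N : Type*) [CommRing A] [AddCommGroup N] [Module A N]
    [Module.Finite A N] [Module.Projective A N] (p : PrimeSpectrum A) :
    ∃ r ∉ p.asIdeal, ∃ (n : ℕ) (v : Fin n → N),
      (∀ c : Fin n → A, ∑ i, c i • v i = 0 → ∃ k : ℕ, ∀ i, r ^ k * c i = 0) ∧
      ∀ m : N, ∃ (k : ℕ) (c : Fin n → A), r ^ k • m = ∑ i, c i • v i := by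
  have : Module.FinitePresentation A N := Module.finitePresentation_of_projective A N
  let S := p.asIdeal.primeCompl
  have : Module.Free (Localization S) (LocalizedModule S N) :=
    Module.free_of_flat_of_isLocalRing
  let b := Module.finBasis (Localization S) (LocalizedModule S N)
  obtain ⟨r, hr, b', -⟩ := Module.FinitePresentation.exists_basis_localizedModule_powers S
    (LocalizedModule.mkLinearMap S N) (Localization S) b
  refine ⟨r, hr, Module.finrank (Localization S) (LocalizedModule S N), ?_⟩
  let P := Submonoid.powers r
  let f := LocalizedModule.mkLinearMap P N
  obtain ⟨⟨_, k, rfl⟩, hk⟩ := IsLocalizedModule.exist_integer_multiples_of_finite P f b'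
  choose v hv using hk
  -- Multiplying the basis of the localization by the unit `r^k` clears its denominators and leaves
  -- a basis `w` that comes from elements `v` of `N`.
  have hu : IsUnit (algebraMap A (Localization P) (r ^ k)) :=
    IsLocalization.map_units (Localization P) (⟨r ^ k, k, rfl⟩ : P)
  let w := b'.isUnitSMul (fun _ => hu)
  have hw (i) : w i = f (v i) := by
    rw [hv, Module.Basis.isUnitSMul_apply, algebraMap_smul]
  refine ⟨v, fun c hc => ?_, fun m => ?_⟩
  · have h1 : ∑ i, algebraMap A (Localization P) (c i) • w i = 0 := by
      simp_rw [hw, algebraMap_smul, ← map_smul, ← map_sum, hc, map_zero]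
    have h2 (i) : ∃ k : ℕ, r ^ k * c i = 0 := by
      have := Fintype.linearIndependent_iff.1 w.linearIndependent _ h1 i
      obtain ⟨⟨_, k, rfl⟩, hk⟩ := (IsLocalization.map_eq_zero_iff P _ _).1 this
      exact ⟨k, hk⟩
    choose k hk using h2
    refine ⟨∑ i, k i, fun i => ?_⟩
    obtain ⟨l, hl⟩ := Nat.exists_eq_add_of_le'
      (Finset.single_le_sum (f := k) (fun _ _ => Nat.zero_le _) (Finset.mem_univ i))
    rw [hl, pow_add, mul_assoc, hk, mul_zero]
  · obtain ⟨⟨_, k, rfl⟩, hk⟩ := IsLocalization.exist_integer_multiples_of_finite P (w.repr (f m))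
    choose c hc using hk
    have h1 : f (r ^ k • m) = f (∑ i, c i • v i) := by
      rw [map_smul, map_sum]
      conv_lhs => rw [← w.sum_repr (f m), Finset.smul_sum]
      refine Finset.sum_congr rfl fun i _ => ?_
      rw [map_smul, ← hw, ← smul_assoc]
      rw [← hc i, algebraMap_smul]
    obtain ⟨⟨_, l, rfl⟩, hl⟩ := (IsLocalizedModule.eq_iff_exists P f).1 h1
    refine ⟨l + k, fun i => r ^ l * c i, ?_⟩
    rw [pow_add, mul_smul]
    have hl' : r ^ l • r ^ k • m = r ^ l • ∑ i, c i • v i := hl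
    rw [hl', Finset.smul_sum]
    simp_rw [mul_smul]

end LocalFreeness

/-! ### Local criteria for bases, and localization on affine opens. -/

namespace AlgebraicGeometry.Scheme.Modules

variable {X Y : Scheme.{u}}

theorem section_ext (M : X.Modules) {U : X.Opens} {s t : Γ(M, U)}
    (h : ∀ x ∈ U, ∃ (V : X.Opens) (hV : V ≤ U), x ∈ V ∧
      M.presheaf.map (homOfLE hV).op s = M.presheaf.map (homOfLE hV).op t) : s = t :=
  TopCat.Presheaf.IsSheaf.section_ext M.isSheaf h

theorem map_sum_smul (M : X.Modules) {ι : Type*} [Fintype ι] {U V W : X.Opens} (s : ι → Γ(M, U))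
    (hV : V ≤ U) (hW : W ≤ V) (c : ι → Γ(X, V)) :
    M.presheaf.map (homOfLE hW).op (∑ i, c i • M.presheaf.map (homOfLE hV).op (s i)) =
      ∑ i, X.presheaf.map (homOfLE hW).op (c i) •
        M.presheaf.map (homOfLE (hW.trans hV)).op (s i) := by
  rw [map_sum]
  simp_rw [Modules.map_smul, map_map_apply]

/-- Being a basis can be tested on a basis of the topology. -/
theorem IsBasisOn.of_locally {M : X.Modules} {ι : Type*} [Fintype ι] {U : X.Opens}
    {s : ι → Γ(M, U)}
    (h : ∀ W ≤ U, ∀ x ∈ W, ∃ V, ∃ hV : V ≤ U, V ≤ W ∧ x ∈ V ∧ Function.Bijective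
      fun c : ι → Γ(X, V) => ∑ i, c i • M.presheaf.map (homOfLE hV).op (s i)) :
    IsBasisOn M U s := by
  -- Uniqueness of coefficients is needed on all opens first: applied to the intersections `V x ⊓ V
  -- y`, it makes the local coefficients compatible for gluing.
  have inj (W : X.Opens) (hW : W ≤ U) (c d : ι → Γ(X, W))
      (hcd : ∑ i, c i • M.presheaf.map (homOfLE hW).op (s i) =
        ∑ i, d i • M.presheaf.map (homOfLE hW).op (s i)) : c = d := by
    funext i
    refine TopCat.Presheaf.IsSheaf.section_ext X.sheaf.property fun x hx => ?_
    obtain ⟨V, hVU, hV, hxV, hbij⟩ := h W hW x hx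
    refine ⟨V, hV, hxV, ?_⟩
    refine congrFun (hbij.1 (a₁ := fun i => X.presheaf.map (homOfLE hV).op (c i))
      (a₂ := fun i => X.presheaf.map (homOfLE hV).op (d i)) ?_) i
    have := congrArg (M.presheaf.map (homOfLE hV).op) hcd
    rwa [map_sum_smul, map_sum_smul] at this
  intro W hW
  refine ⟨fun c d => inj W hW c d, fun m => ?_⟩
  choose V hVU hVW hxV hbij using fun x : W => h W hW x.1 x.2
  choose c hc using fun x : W => (hbij x).2 (M.presheaf.map (homOfLE (hVW x)).op m)
  have hcompat (i : ι) (x y : W) :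
      X.presheaf.map (homOfLE (inf_le_left : V x ⊓ V y ≤ V x)).op (c x i) =
      X.presheaf.map (homOfLE (inf_le_right : V x ⊓ V y ≤ V y)).op (c y i) := by
    refine congrFun (inj (V x ⊓ V y) (inf_le_left.trans (hVU x))
      (fun i => X.presheaf.map (homOfLE inf_le_left).op (c x i))
      (fun i => X.presheaf.map (homOfLE inf_le_right).op (c y i)) ?_) i
    have h1 := congrArg (M.presheaf.map (homOfLE (inf_le_left : V x ⊓ V y ≤ V x)).op) (hc x)
    have h2 := congrArg (M.presheaf.map (homOfLE (inf_le_right : V x ⊓ V y ≤ V y)).op) (hc y)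
    rw [map_sum_smul, map_map_apply] at h1 h2
    rw [h1, h2]
  obtain ⟨d, hd⟩ : ∃ d : ι → Γ(X, W), ∀ i x, X.presheaf.map (homOfLE (hVW x)).op (d i) = c x i := by
    choose d hd using fun i => (TopCat.Sheaf.existsUnique_gluing' X.sheaf V W
      (fun x => homOfLE (hVW x)) (fun x hx => TopologicalSpace.Opens.mem_iSup.2 ⟨⟨x, hx⟩, hxV _⟩)
      (fun x => c x i) (fun x y => hcompat i x y)).exists
    exact ⟨d, hd⟩
  refine ⟨d, M.section_ext fun x hx => ⟨V ⟨x, hx⟩, hVW _, hxV _, ?_⟩⟩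
  rw [← hc ⟨x, hx⟩]
  dsimp only
  rw [map_sum_smul]
  simp_rw [hd]

/-- The sections of `M` over the basic opens of `U` are localizations of the sections over `U`. -/
structure LocalizesOn (M : X.Modules) (U : X.Opens) : Prop where
  exists_pow_smul_eq_zero : ∀ (f : Γ(X, U)) (m : Γ(M, U)),
    M.presheaf.map (homOfLE (X.basicOpen_le f)).op m = 0 → ∃ n : ℕ, f ^ n • m = 0
  exists_map_eq : ∀ (f : Γ(X, U)) (m : Γ(M, X.basicOpen f)), ∃ (n : ℕ) (m' : Γ(M, U)),
    M.presheaf.map (homOfLE (X.basicOpen_le f)).op m' =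
      X.presheaf.map (homOfLE (X.basicOpen_le f)).op f ^ n • m

theorem localizesOn_unit {U : X.Opens} (hU : IsAffineOpen U) : LocalizesOn (unit X) U where
  exists_pow_smul_eq_zero f m h :=
    exists_pow_mul_eq_zero_of_res_basicOpen_eq_zero_of_isCompact X hU.isCompact m f h
  exists_map_eq f m := exists_eq_pow_mul_of_isAffineOpen X U hU f m

theorem _root_.AlgebraicGeometry.IsAffineOpen.exists_common_denominator {U : X.Opens}
    (hU : IsAffineOpen U) {ι : Type*} [Fintype ι] (f : Γ(X, U)) (c : ι → Γ(X, X.basicOpen f)) :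
    ∃ (n : ℕ) (d : ι → Γ(X, U)), ∀ i, X.presheaf.map (homOfLE (X.basicOpen_le f)).op (d i) =
      X.presheaf.map (homOfLE (X.basicOpen_le f)).op f ^ n * c i := by
  have h (i : ι) : ∃ (n : ℕ) (d : Γ(X, U)), X.presheaf.map (homOfLE (X.basicOpen_le f)).op d =
      X.presheaf.map (homOfLE (X.basicOpen_le f)).op f ^ n * c i :=
    (localizesOn_unit hU).exists_map_eq f (c i)
  choose n d hd using h
  -- The sum of the exponents serves as a common exponent; the truncated subtraction is exact
  -- because each `n i` is at most the sum.
  refine ⟨∑ i, n i, fun i => f ^ (∑ j, n j - n i) * d i, fun i => ?_⟩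
  rw [map_mul, hd, map_pow, ← mul_assoc, ← pow_add, Nat.sub_add_cancel]
  exact Finset.single_le_sum (f := n) (fun _ _ => Nat.zero_le _) (Finset.mem_univ i)

theorem IsBasisOn.localizesOn {M : X.Modules} {ι : Type*} [Fintype ι] {U : X.Opens}
    {s : ι → Γ(M, U)} (hs : IsBasisOn M U s) (hU : IsAffineOpen U) : LocalizesOn M U where
  exists_pow_smul_eq_zero f m h := by
    obtain ⟨c, rfl⟩ := (hs U le_rfl).2 m
    dsimp only at h
    rw [map_sum_smul] at h
    have h1 := (hs _ (X.basicOpen_le f)).1 (a₂ := 0) (h.trans (by simp))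
    choose n hn using fun i =>
      (localizesOn_unit hU).exists_pow_smul_eq_zero f (c i) (congrFun h1 i)
    refine ⟨∑ i, n i, ?_⟩
    dsimp only
    rw [Finset.smul_sum]
    refine Finset.sum_eq_zero fun i _ => ?_
    obtain ⟨l, hl⟩ := Nat.exists_eq_add_of_le'
      (Finset.single_le_sum (f := n) (fun _ _ => Nat.zero_le _) (Finset.mem_univ i))
    have h2 : f ^ n i * c i = 0 := hn i
    rw [hl, pow_add, mul_smul, ← mul_smul (f ^ n i), h2, zero_smul, smul_zero]
  exists_map_eq f m := by
    obtain ⟨c, rfl⟩ := (hs _ (X.basicOpen_le f)).2 m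
    obtain ⟨n, d, hd⟩ := hU.exists_common_denominator f c
    refine ⟨n, ∑ i, d i • M.presheaf.map (homOfLE le_rfl).op (s i), ?_⟩
    dsimp only
    rw [map_sum_smul, Finset.smul_sum]
    simp_rw [hd, mul_smul]

theorem _root_.AlgebraicGeometry.IsAffineOpen.mem_basicOpen_iff {U : X.Opens} (hU : IsAffineOpen U)
    (x : U) (f : Γ(X, U)) : x.1 ∈ X.basicOpen f ↔ f ∉ (hU.primeIdealOf x).asIdeal := by
  rw [← PrimeSpectrum.mem_basicOpen, ← hU.fromSpec_preimage_basicOpen f]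
  change _ ↔ hU.fromSpec (hU.primeIdealOf x) ∈ X.basicOpen f
  rw [hU.fromSpec_primeIdealOf]

theorem isUnit_map_basicOpen {U V : X.Opens} (f : Γ(X, U)) (h : V ≤ U) (hV : V ≤ X.basicOpen f) :
    IsUnit (X.presheaf.map (homOfLE h).op f) := by
  have h1 := (RingedSpace.isUnit_res_basicOpen X.toRingedSpace f).map
    (X.presheaf.map (homOfLE hV).op).hom
  have h2 : X.presheaf.map (homOfLE hV).op (X.presheaf.map (homOfLE (X.basicOpen_le f)).op f) =
      X.presheaf.map (homOfLE h).op f := by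
    rw [← ConcreteCategory.comp_apply, ← Functor.map_comp]
    rfl
  rw [← h2]
  exact h1

/-- If the sections of `M` over the affine open `U` form a finite projective module and `M` localizes
on `U`, then `M` has local bases on `U`. -/
theorem LocalizesOn.exists_isBasisOn {M : X.Modules} {U : X.Opens} (hM : LocalizesOn M U)
    (hU : IsAffineOpen U) [Module.Finite Γ(X, U) Γ(M, U)] [Module.Projective Γ(X, U) Γ(M, U)]
    {x : X} (hx : x ∈ U) :
    ∃ (f : Γ(X, U)) (n : ℕ) (s : Fin n → Γ(M, X.basicOpen f)),
      x ∈ X.basicOpen f ∧ IsBasisOn M (X.basicOpen f) s := by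
  obtain ⟨r, hr, n, v, hinj, hsurj⟩ :=
    Module.exists_basis_up_to_powers Γ(X, U) Γ(M, U) (hU.primeIdealOf ⟨x, hx⟩)
  refine ⟨r, n, fun i => M.presheaf.map (homOfLE (X.basicOpen_le r)).op (v i),
    (hU.mem_basicOpen_iff ⟨x, hx⟩ r).2 hr, .of_locally fun W hW y hy => ?_⟩
  obtain ⟨g, hgW, hyg⟩ := hU.exists_basicOpen_le ⟨y, hy⟩ (X.basicOpen_le r (hW hy))
  have hgr := X.basicOpen_mul g r
  -- Sets of the form `D(g * r)` are basic opens of `U`, so `LocalizesOn` applies to them, and both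
  -- `r` and `g * r` are invertible there, so that all denominators can be divided out.
  refine ⟨X.basicOpen (g * r), hgr ▸ inf_le_right, (hgr ▸ inf_le_left).trans hgW,
    hgr ▸ ⟨hyg, hW hy⟩, ?_⟩
  simp_rw [map_map_apply]
  set D := X.basicOpen (g * r)
  have hD : D ≤ U := X.basicOpen_le _
  have hug : IsUnit (X.presheaf.map (homOfLE hD).op (g * r)) := isUnit_map_basicOpen _ _ le_rfl
  have hur : IsUnit (X.presheaf.map (homOfLE hD).op r) :=
    isUnit_map_basicOpen _ _ (hgr ▸ inf_le_right)
  constructor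
  · have key (e : Fin n → Γ(X, D))
        (he : ∑ i, e i • M.presheaf.map (homOfLE hD).op (v i) = 0) : e = 0 := by
      obtain ⟨K, e', he'⟩ := hU.exists_common_denominator (g * r) e
      have h1 : M.presheaf.map (homOfLE hD).op (∑ i, e' i • v i) = 0 := by
        rw [map_sum]
        simp_rw [Modules.map_smul, he', mul_smul]
        rw [← Finset.smul_sum, he, smul_zero]
      obtain ⟨l, hl⟩ := hM.exists_pow_smul_eq_zero (g * r) _ h1
      rw [Finset.smul_sum] at hl
      simp_rw [← mul_smul] at hl
      obtain ⟨k, hk⟩ := hinj _ hl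
      funext i
      have h2 := congrArg (X.presheaf.map (homOfLE hD).op) (hk i)
      rw [map_mul, map_mul, map_pow, map_pow, he', map_zero, (hur.pow k).mul_right_eq_zero,
        (hug.pow l).mul_right_eq_zero, (hug.pow K).mul_right_eq_zero] at h2
      exact h2
    intro c d hcd
    rw [← sub_eq_zero]
    apply key
    simp_rw [Pi.sub_apply, sub_smul, Finset.sum_sub_distrib]
    exact sub_eq_zero.2 hcd
  · intro m
    obtain ⟨k, m', hm'⟩ := hM.exists_map_eq (g * r) m
    obtain ⟨l, c, hc⟩ := hsurj m'
    obtain ⟨a, ha⟩ := hur.pow l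
    obtain ⟨b, hb⟩ := hug.pow k
    refine ⟨fun i => ↑b⁻¹ * (↑a⁻¹ * X.presheaf.map (homOfLE hD).op (c i)), ?_⟩
    dsimp only
    simp_rw [mul_smul]
    rw [← Finset.smul_sum, ← Finset.smul_sum]
    have h1 : M.presheaf.map (homOfLE hD).op (∑ i, c i • v i) = ∑ i,
        X.presheaf.map (homOfLE hD).op (c i) • M.presheaf.map (homOfLE hD).op (v i) := by
      rw [map_sum]
      simp_rw [Modules.map_smul]
    rw [← h1, ← hc, Modules.map_smul, hm', map_pow, ← ha, ← hb]
    simp only [← mul_smul]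
    simp

end AlgebraicGeometry.Scheme.Modules

/-! ### Localization and bases of pushforwards. -/

namespace AlgebraicGeometry.Scheme.Modules

variable {X Y : Scheme.{u}}

theorem LocalizesOn.pushforward (p : Y ⟶ X) {F : Y.Modules} {U : X.Opens}
    (hF : LocalizesOn F (p ⁻¹ᵁ U)) : LocalizesOn ((pushforward p).obj F) U where
  exists_pow_smul_eq_zero f m h := by
    -- The preimage of `D(f)` equals the basic open of the pulled-back function only
    -- propositionally; a variable `V` allows the equality to be substituted.
    have key : ∀ (V : Y.Opens) (hV : V ≤ p ⁻¹ᵁ U), V = Y.basicOpen (p.app U f) →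
        F.presheaf.map (homOfLE hV).op (show Γ(F, p ⁻¹ᵁ U) from m) = 0 →
        ∃ n : ℕ, p.app U f ^ n • (show Γ(F, p ⁻¹ᵁ U) from m) = 0 := by
      rintro V hV rfl h
      exact hF.exists_pow_smul_eq_zero _ _ h
    obtain ⟨n, hn⟩ := key _ (p.preimage_mono (X.basicOpen_le f)) (Scheme.preimage_basicOpen p f) h
    refine ⟨n, ?_⟩
    rw [← map_pow] at hn
    exact hn
  exists_map_eq f m := by
    have key : ∀ (V : Y.Opens) (hV : V ≤ p ⁻¹ᵁ U) (m : Γ(F, V)), V = Y.basicOpen (p.app U f) →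
        ∃ (n : ℕ) (m' : Γ(F, p ⁻¹ᵁ U)), F.presheaf.map (homOfLE hV).op m' =
          Y.presheaf.map (homOfLE hV).op (p.app U f) ^ n • m := by
      rintro V hV m rfl
      exact hF.exists_map_eq _ _
    obtain ⟨n, m', hm'⟩ := key _ (p.preimage_mono (X.basicOpen_le f)) m
      (Scheme.preimage_basicOpen p f)
    refine ⟨n, m', hm'.trans ?_⟩
    have h1 : Y.presheaf.map (homOfLE (p.preimage_mono (X.basicOpen_le f))).op (p.app U f) =
        p.app (X.basicOpen f) (X.presheaf.map (homOfLE (X.basicOpen_le f)).op f) :=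
      (ConcreteCategory.congr_hom (p.naturality (homOfLE (X.basicOpen_le f)).op) f).symm
    rw [h1, ← map_pow]
    rfl

/-- Transitivity of freeness: expand a section in the `t i`, then each coefficient in the `b j`; the
products `b j • t i` form the basis. -/
theorem IsBasisOn.pushforward (p : Y ⟶ X) {F : Y.Modules} {U : X.Opens}
    {κ ι : Type*} [Fintype κ] [Fintype ι]
    {b : κ → Γ((Modules.pushforward p).obj (unit Y), U)} {t : ι → Γ(F, p ⁻¹ᵁ U)}
    (hb : IsBasisOn ((Modules.pushforward p).obj (unit Y)) U b) (ht : IsBasisOn F (p ⁻¹ᵁ U) t) :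
    IsBasisOn ((Modules.pushforward p).obj F) U
      fun ji : κ × ι => (show Γ(F, p ⁻¹ᵁ U) from (show Γ(Y, p ⁻¹ᵁ U) from b ji.1) • t ji.2) := by
  intro W hW
  have h1 := ht (p ⁻¹ᵁ W) (p.preimage_mono hW)
  have h2 : Function.Bijective fun (c : ι → κ → Γ(X, W)) i => ∑ j, c i j •
      ((Modules.pushforward p).obj (unit Y)).presheaf.map (homOfLE hW).op (b j) :=
    Function.Bijective.piMap fun _ => hb W hW
  have h3 := (h1.comp h2).comp
    ((Equiv.arrowCongr (Equiv.prodComm κ ι) (Equiv.refl Γ(X, W))).trans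
      (Equiv.curry ι κ Γ(X, W))).bijective
  refine (congrArg Function.Bijective (funext fun c => ?_)).mpr h3
  rw [Fintype.sum_prod_type_right]
  refine Finset.sum_congr rfl fun i _ => ?_
  have h4 (j : κ) : ((Modules.pushforward p).obj F).presheaf.map (homOfLE hW).op
      (show Γ(F, p ⁻¹ᵁ U) from (show Γ(Y, p ⁻¹ᵁ U) from b j) • t i) =
      (show Γ(F, p ⁻¹ᵁ W) from Y.presheaf.map (homOfLE (p.preimage_mono hW)).op
        (show Γ(Y, p ⁻¹ᵁ U) from b j) • F.presheaf.map (homOfLE (p.preimage_mono hW)).op (t i)) :=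
    Modules.map_smul F _ _ _
  simp_rw [h4]
  change ∑ j : κ, p.app W (c (j, i)) • (Y.presheaf.map (homOfLE (p.preimage_mono hW)).op
        (show Γ(Y, p ⁻¹ᵁ U) from b j) • F.presheaf.map (homOfLE (p.preimage_mono hW)).op (t i)) =
    (∑ j : κ, p.app W (c (j, i)) * Y.presheaf.map (homOfLE (p.preimage_mono hW)).op
        (show Γ(Y, p ⁻¹ᵁ U) from b j)) • F.presheaf.map (homOfLE (p.preimage_mono hW)).op (t i)
  rw [Finset.sum_smul]
  simp_rw [mul_smul]

/-! ### Exactness on sections -/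

/-- Sections over an open set, as a functor to abelian groups. -/
def sectionsFunctor (U : X.Opens) : X.Modules ⥤ Ab :=
  toPresheaf X ⋙ (CategoryTheory.evaluation _ _).obj (.op U)

instance (U : X.Opens) : (sectionsFunctor U).PreservesZeroMorphisms where
  map_zero _ _ := rfl

instance (U : X.Opens) : Limits.PreservesLimitsOfSize.{u, u} (sectionsFunctor U) :=
  have : Limits.PreservesLimitsOfSize.{u, u}
      ((CategoryTheory.evaluation X.Opensᵒᵖ Ab.{u}).obj (.op U)) := ⟨inferInstance⟩
  Limits.comp_preservesLimits _ _

theorem injective_app_of_mono {M N : X.Modules} (φ : M ⟶ N) [Mono φ] (U : X.Opens) :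
    Function.Injective (φ.app U) :=
  (AddCommGrpCat.mono_iff_injective ((sectionsFunctor U).map φ)).1 inferInstance

theorem exists_app_eq {T : ShortComplex X.Modules} (hT : T.ShortExact) (U : X.Opens)
    (m : Γ(T.X₂, U)) (hm : T.g.app U m = 0) : ∃ k, T.f.app U k = m := by
  have := hT.mono_f
  exact (ShortComplex.ab_exact_iff _).1
    (hT.exact.map_of_mono_of_preservesKernel (sectionsFunctor U) this inferInstance) m hm

theorem app_g_app_f {T : ShortComplex X.Modules} (U : X.Opens) (k : Γ(T.X₁, U)) :
    T.g.app U (T.f.app U k) = 0 :=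
  congrArg (fun φ : T.X₁ ⟶ T.X₃ => φ.app U k) T.zero

theorem epi_of_locally_surjective {M N : X.Modules} (φ : M ⟶ N)
    (h : ∀ (U : X.Opens) (n : Γ(N, U)), ∀ x ∈ U, ∃ (V : X.Opens) (hV : V ≤ U) (m : Γ(M, V)),
      x ∈ V ∧ φ.app V m = N.presheaf.map (homOfLE hV).op n) : Epi φ where
  left_cancellation {P} a b hab := by
    ext U n
    refine P.section_ext fun x hx => ?_
    obtain ⟨V, hV, m, hxV, hm⟩ := h U n x hx
    refine ⟨V, hV, hxV, ?_⟩
    rw [← Hom.app_map, ← Hom.app_map, ← hm]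
    exact congrArg (fun ψ : M ⟶ P => ψ.app V m) hab

/-- The kernel of a surjection of locally free modules is locally free. -/
theorem exists_isBasisOn_kernel {T : ShortComplex X.Modules} (hT : T.ShortExact) {U : X.Opens}
    (hU : IsAffineOpen U) {ι κ : Type*} [Fintype ι] [Fintype κ] {s : ι → Γ(T.X₂, U)}
    {t : κ → Γ(T.X₃, U)} (hs : IsBasisOn T.X₂ U s) (ht : IsBasisOn T.X₃ U t)
    (hg : Function.Surjective (T.g.app U)) {x : X} (hx : x ∈ U) :
    ∃ (V : X.Opens) (n : ℕ) (v : Fin n → Γ(T.X₁, V)), x ∈ V ∧ IsBasisOn T.X₁ V v := by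
  have := hT.mono_f
  have hinj := injective_app_of_mono T.f
  -- Localization passes to the kernel. If `m'` extends `f^n • m` in the middle term, its image on
  -- the right vanishes on `D(f)` and is killed by some `f^l`; then `f^l • m'` lies in the kernel.
  have hL : LocalizesOn T.X₁ U :=
    { exists_pow_smul_eq_zero := fun f m hm => by
        obtain ⟨n, hn⟩ := (hs.localizesOn hU).exists_pow_smul_eq_zero f (T.f.app U m) (by
          rw [← Hom.app_map, hm, map_zero])
        refine ⟨n, hinj U ?_⟩
        rw [Hom.app_smul, hn, map_zero]
      exists_map_eq := fun f m => by
        obtain ⟨n, m', hm'⟩ := (hs.localizesOn hU).exists_map_eq f (T.f.app _ m)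
        obtain ⟨l, hl⟩ := (ht.localizesOn hU).exists_pow_smul_eq_zero f (T.g.app U m') (by
          rw [← Hom.app_map, hm', Hom.app_smul, app_g_app_f, smul_zero])
        obtain ⟨k, hk⟩ := exists_app_eq hT U (f ^ l • m') (by rw [Hom.app_smul, hl])
        refine ⟨l + n, k, hinj _ ?_⟩
        rw [Hom.app_map, hk, Modules.map_smul, hm', Hom.app_smul, map_pow, pow_add, mul_smul] }
  let e₂ : (ι → Γ(X, U)) ≃ₗ[Γ(X, U)] Γ(T.X₂, U) :=
    LinearEquiv.ofBijective (Fintype.linearCombination Γ(X, U) s) (by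
      convert hs U le_rfl using 1
      funext c
      refine Finset.sum_congr rfl fun i _ => congrArg (c i • ·) ?_
      exact (ConcreteCategory.congr_hom (T.X₂.presheaf.map_id _) (s i)).symm)
  let e₃ : (κ → Γ(X, U)) ≃ₗ[Γ(X, U)] Γ(T.X₃, U) :=
    LinearEquiv.ofBijective (Fintype.linearCombination Γ(X, U) t) (by
      convert ht U le_rfl using 1
      funext c
      refine Finset.sum_congr rfl fun i _ => congrArg (c i • ·) ?_
      exact (ConcreteCategory.congr_hom (T.X₃.presheaf.map_id _) (t i)).symm)
  have := Module.Finite.equiv e₂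
  have := Module.Projective.of_equiv' e₂
  have := Module.Projective.of_equiv' e₃
  let f' : Γ(T.X₁, U) →ₗ[Γ(X, U)] Γ(T.X₂, U) :=
    { toFun := T.f.app U, map_add' := map_add _, map_smul' := T.f.app_smul }
  let g' : Γ(T.X₂, U) →ₗ[Γ(X, U)] Γ(T.X₃, U) :=
    { toFun := T.g.app U, map_add' := map_add _, map_smul' := T.g.app_smul }
  have hex : Function.Exact f' g' := fun m =>
    ⟨fun hm => exists_app_eq hT U m hm, by rintro ⟨k, rfl⟩; exact app_g_app_f U k⟩
  -- Surjectivity on sections over `U` splits the sequence there, so the sections of the kernel are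
  -- a direct summand of a finite free module.
  obtain ⟨l, hl⟩ := Module.projective_lifting_property g' LinearMap.id hg
  obtain ⟨e, -⟩ : ∃ e : Γ(T.X₂, U) ≃ₗ[Γ(X, U)] Γ(T.X₁, U) × Γ(T.X₃, U),
      f' = e.symm ∘ₗ LinearMap.inl Γ(X, U) Γ(T.X₁, U) Γ(T.X₃, U) ∧
        g' = LinearMap.snd Γ(X, U) Γ(T.X₁, U) Γ(T.X₃, U) ∘ₗ e :=
    (hex.split_tfae'.out 0 2).1
      (show Function.Injective f' ∧ ∃ l, g' ∘ₗ l = LinearMap.id from ⟨hinj U, l, hl⟩)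
  have : Module.Finite Γ(X, U) Γ(T.X₁, U) :=
    Module.Finite.of_surjective (LinearMap.fst Γ(X, U) Γ(T.X₁, U) Γ(T.X₃, U) ∘ₗ e.toLinearMap)
      (Prod.fst_surjective.comp e.surjective)
  have : Module.Projective Γ(X, U) Γ(T.X₁, U) :=
    Module.Projective.of_split (e.symm.toLinearMap ∘ₗ LinearMap.inl Γ(X, U) Γ(T.X₁, U) Γ(T.X₃, U))
      (LinearMap.fst Γ(X, U) Γ(T.X₁, U) Γ(T.X₃, U) ∘ₗ e.toLinearMap) (by ext; simp)
  obtain ⟨f, n, v, hxf, hv⟩ := hL.exists_isBasisOn hU hx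
  exact ⟨_, n, v, hxf, hv⟩

end AlgebraicGeometry.Scheme.Modules

/-! ### Infinitesimal neighbourhoods of consecutive orders. -/

namespace infinitesimalNbhd

open Limits AlgebraicGeometry.Scheme

variable {X S : Scheme.{u}} (f : X ⟶ S) (k : ℕ)

theorem fst_preimage_eq_snd_preimage (U : X.Opens) : fst f k ⁻¹ᵁ U = snd f k ⁻¹ᵁ U := by
  ext z
  change fst f k z ∈ U ↔ snd f k z ∈ U
  rw [fst_apply_eq_snd_apply]

/-- The closed immersion of the infinitesimal neighbourhood into the open subscheme of `X ×_S X` in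
which the diagonal is closed. -/
def toCoborder : infinitesimalNbhd f k ⟶ (pullback.diagonal f).coborderRange.toScheme :=
  ((pullback.diagonal f).liftCoborder.ker ^ (k + 1)).subschemeι

theorem toCoborder_fst : toCoborder f k ≫ (pullback.diagonal f).coborderRange.ι ≫
    pullback.fst f f = fst f k := (Category.assoc _ _ _).symm

theorem toCoborder_snd : toCoborder f k ≫ (pullback.diagonal f).coborderRange.ι ≫
    pullback.snd f f = snd f k := (Category.assoc _ _ _).symm

instance : IsClosedImmersion (toCoborder f k) :=
  inferInstanceAs (IsClosedImmersion ((pullback.diagonal f).liftCoborder.ker ^ (k + 1)).subschemeι)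

theorem ker_toCoborder_app {W : (pullback.diagonal f).coborderRange.toScheme.Opens}
    (hW : IsAffineOpen W) :
    RingHom.ker ((toCoborder f k).app W).hom =
      RingHom.ker ((pullback.diagonal f).liftCoborder.app W).hom ^ (k + 1) := by
  refine (IdealSheafData.ker_subschemeι_app _ ⟨W, hW⟩).trans ?_
  rw [IdealSheafData.ideal_pow, Pi.pow_apply, Hom.ker_apply]

/-- The closed immersion of an infinitesimal neighbourhood of the diagonal into the next one. -/
def transition : infinitesimalNbhd f k ⟶ infinitesimalNbhd f (k + 1) :=
  IdealSheafData.inclusion fun _ => Ideal.pow_le_pow_right k.succ.le_succ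

theorem transition_toCoborder : transition f k ≫ toCoborder f (k + 1) = toCoborder f k :=
  IdealSheafData.inclusion_subschemeι _

theorem transition_fst : transition f k ≫ fst f (k + 1) = fst f k := by
  rw [← toCoborder_fst, ← toCoborder_fst, ← Category.assoc, transition_toCoborder]

theorem transition_snd : transition f k ≫ snd f (k + 1) = snd f k := by
  rw [← toCoborder_snd, ← toCoborder_snd, ← Category.assoc, transition_toCoborder]

instance : IsClosedImmersion (transition f k) := by
  have : IsClosedImmersion (transition f k ≫ toCoborder f (k + 1)) := by
    rw [transition_toCoborder]
    infer_instance
  exact .of_comp_isClosedImmersion _ (toCoborder f (k + 1))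

/-- The neighbourhood of order `0` is cut out by `I^1 = I`. The diagonal maps to it by an
epimorphism, and both projections composed with the diagonal are the identity. -/
theorem fst_zero_eq_snd_zero : fst f 0 = snd f 0 := by
  have key (J : IdealSheafData (pullback.diagonal f).coborderRange.toScheme)
      (hJ : J = (pullback.diagonal f).liftCoborder.ker) :
      (J.subschemeι ≫ (pullback.diagonal f).coborderRange.ι) ≫ pullback.fst f f =
        (J.subschemeι ≫ (pullback.diagonal f).coborderRange.ι) ≫ pullback.snd f f := by
    subst hJ
    rw [← cancel_epi (pullback.diagonal f).liftCoborder.toImage]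
    have h : (pullback.diagonal f).liftCoborder.toImage ≫
        (pullback.diagonal f).liftCoborder.ker.subschemeι ≫
          (pullback.diagonal f).coborderRange.ι = pullback.diagonal f := by
      rw [← Category.assoc]
      exact (congrArg (· ≫ (pullback.diagonal f).coborderRange.ι)
        (Hom.toImage_imageι (pullback.diagonal f).liftCoborder)).trans (Hom.liftCoborder_ι _)
    rw [← Category.assoc, ← Category.assoc]
    erw [h]
    simp
  exact key _ (pow_one _)

/-- Locally `c` lifts to an element of `I^(k+1)`, the ideal of the smaller neighbourhood, while the
two pullbacks of `a` differ by an element of `I`. Their product lies in `I^(k+2)`, which vanishes on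
the larger neighbourhood. Shrinking to `W` cut out by an affine open makes lifts and kernels
computable. -/
theorem exists_fst_mul_eq_snd_mul {U : X.Opens} (a : Γ(X, U))
    {V : (infinitesimalNbhd f (k + 1)).Opens} (hV : V ≤ fst f (k + 1) ⁻¹ᵁ U)
    {z : infinitesimalNbhd f (k + 1)} (hz : z ∈ V) :
    ∃ (W : (infinitesimalNbhd f (k + 1)).Opens) (h₁ : W ≤ fst f (k + 1) ⁻¹ᵁ U)
      (h₂ : W ≤ snd f (k + 1) ⁻¹ᵁ U), W ≤ V ∧ z ∈ W ∧
      ∀ c : Γ(infinitesimalNbhd f (k + 1), W), (transition f k).app W c = 0 →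
        (fst f (k + 1)).appLE U W h₁ a * c = (snd f (k + 1)).appLE U W h₂ a * c := by
  let d := (pullback.diagonal f).liftCoborder
  let j := toCoborder f (k + 1)
  let o := (pullback.diagonal f).coborderRange.ι
  obtain ⟨V', rfl⟩ : ∃ V' : (pullback.diagonal f).coborderRange.toScheme.Opens, j ⁻¹ᵁ V' = V := by
    obtain ⟨t, ht, e⟩ := j.isEmbedding.isInducing.isOpen_iff.mp V.isOpen
    exact ⟨⟨t, ht⟩, TopologicalSpace.Opens.ext e⟩
  have hz₁ : z ∈ fst f (k + 1) ⁻¹ᵁ U := hV hz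
  have hz₂ : z ∈ snd f (k + 1) ⁻¹ᵁ U := fst_preimage_eq_snd_preimage f (k + 1) U ▸ hz₁
  obtain ⟨_, ⟨W, hW, rfl⟩, hzW, hWV⟩ :=
    (pullback.diagonal f).coborderRange.toScheme.isBasis_affineOpens.exists_subset_of_mem_open
      (show j z ∈ V' ⊓ (o ⁻¹ᵁ pullback.fst f f ⁻¹ᵁ U ⊓ o ⁻¹ᵁ pullback.snd f f ⁻¹ᵁ U) from
        ⟨hz, hz₁, hz₂⟩) (TopologicalSpace.Opens.isOpen _)
  have hW₁ : W ≤ (o ≫ pullback.fst f f) ⁻¹ᵁ U := fun w hw => (hWV hw).2.1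
  have hW₂ : W ≤ (o ≫ pullback.snd f f) ⁻¹ᵁ U := fun w hw => (hWV hw).2.2
  refine ⟨j ⁻¹ᵁ W, fun w hw => (hWV hw).2.1, fun w hw => (hWV hw).2.2, fun w hw => (hWV hw).1, hzW,
    fun c hc => ?_⟩
  obtain ⟨b, rfl⟩ := j.app_surjective W hW c
  have hb : b ∈ RingHom.ker (d.app W).hom ^ (k + 1) := by
    rw [← ker_toCoborder_app f k hW, RingHom.mem_ker]
    have key (g : infinitesimalNbhd f k ⟶ (pullback.diagonal f).coborderRange.toScheme)
        (hg : g = toCoborder f k) (h : g.app W b = 0) : (toCoborder f k).app W b = 0 := by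
      subst hg
      exact h
    exact key _ (transition_toCoborder f k)
      ((ConcreteCategory.congr_hom (Hom.comp_app (transition f k) j W) b).trans hc)
  have hd₁ : d ≫ o ≫ pullback.fst f f = 𝟙 X := by
    rw [Hom.liftCoborder_ι_assoc, pullback.diagonal_fst]
  have hd₂ : d ≫ o ≫ pullback.snd f f = 𝟙 X := by
    rw [Hom.liftCoborder_ι_assoc, pullback.diagonal_snd]
  have hd (h : d ⁻¹ᵁ W ≤ U) (g : (pullback.diagonal f).coborderRange.toScheme ⟶ X)
      (hg : d ≫ g = 𝟙 X) (hgW : W ≤ g ⁻¹ᵁ U) :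
      d.app W (g.appLE U W hgW a) = X.presheaf.map (homOfLE h).op a := by
    have h := ConcreteCategory.congr_hom (Hom.appLE_comp_appLE d g U W (d ⁻¹ᵁ W) hgW le_rfl) a
    rw [Hom.appLE_eq_app, CommRingCat.comp_apply] at h
    rw [h]
    simp only [hg]
    rw [Hom.appLE, Hom.id_app]
    rfl
  have hle : d ⁻¹ᵁ W ≤ U := by
    intro w hw
    have := hW₁ hw
    change (d ≫ o ≫ pullback.fst f f) w ∈ U at this
    rwa [hd₁] at this
  have ha : (o ≫ pullback.fst f f).appLE U W hW₁ a - (o ≫ pullback.snd f f).appLE U W hW₂ a ∈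
      RingHom.ker (d.app W).hom := by
    rw [RingHom.mem_ker, map_sub, sub_eq_zero]
    exact (hd hle _ hd₁ hW₁).trans (hd hle _ hd₂ hW₂).symm
  have hab := Ideal.mul_mem_mul ha hb
  rw [← pow_succ', ← ker_toCoborder_app f (k + 1) hW, RingHom.mem_ker, map_mul, map_sub, sub_mul,
    sub_eq_zero] at hab
  have hj₁ : j.app W ((o ≫ pullback.fst f f).appLE U W hW₁ a) =
      (fst f (k + 1)).appLE U (j ⁻¹ᵁ W) (fun w hw => (hWV hw).2.1) a := by
    have h := ConcreteCategory.congr_hom (Hom.appLE_comp_appLE j _ U W (j ⁻¹ᵁ W) hW₁ le_rfl) a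
    rwa [Hom.appLE_eq_app] at h
  have hj₂ : j.app W ((o ≫ pullback.snd f f).appLE U W hW₂ a) =
      (snd f (k + 1)).appLE U (j ⁻¹ᵁ W) (fun w hw => (hWV hw).2.2) a := by
    have h := ConcreteCategory.congr_hom (Hom.appLE_comp_appLE j _ U W (j ⁻¹ᵁ W) hW₂ le_rfl) a
    rwa [Hom.appLE_eq_app] at h
  rw [← hj₁, ← hj₂]
  exact hab

end infinitesimalNbhd

/-! ### Translation of the algebra to affine charts of the neighbourhoods. -/

section

theorem Ideal.comap_pow_of_bijective {B C : Type*} [CommRing B] [CommRing C] (e : B →+* C)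
    (he : Function.Bijective e) (I : Ideal C) (n : ℕ) : (I ^ n).comap e = I.comap e ^ n := by
  have h (J : Ideal C) : J.comap e = J.map (RingEquiv.ofBijective e he).symm :=
    (Ideal.map_symm (RingEquiv.ofBijective e he)).symm
  rw [h, h, Ideal.map_pow]

/-- Here `T` stands for the functions on `U ×_S U`, `δ` for restriction to the diagonal and `ρ` for
restriction to a neighbourhood. The pushout isomorphism carries multiplication to `δ`, hence
`KaehlerDifferential.ideal R A` to the kernel of `δ`. -/
theorem IsDifferentiallySmoothAlgebra.finiteProjectiveAlong_of_isPushout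
    {R A T C : CommRingCat.{u}} {φ : R ⟶ A}
    (h : letI := φ.hom.toAlgebra; IsDifferentiallySmoothAlgebra R A)
    {i₁ i₂ : A ⟶ T} (hT : IsPushout φ φ i₁ i₂) (δ : T ⟶ A) (h₁ : i₁ ≫ δ = 𝟙 A)
    (h₂ : i₂ ≫ δ = 𝟙 A) (ρ : T ⟶ C) (hρ : Function.Surjective ρ.hom) (n : ℕ)
    (hn : RingHom.ker ρ.hom = RingHom.ker δ.hom ^ n) :
    FiniteProjectiveAlong (i₁ ≫ ρ).hom C ∧ FiniteProjectiveAlong (i₂ ≫ ρ).hom C := by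
  let _ := φ.hom.toAlgebra
  have hp := CommRingCat.isPushout_tensorProduct R A A
  let e := hp.isoIsPushout _ _ hT
  have he₁ : _ ≫ e.hom = i₁ := IsPushout.inl_isoIsPushout_hom _ _ hp hT
  have he₂ : _ ≫ e.hom = i₂ := IsPushout.inr_isoIsPushout_hom _ _ hp hT
  have hb : Function.Bijective e.hom.hom := ConcreteCategory.bijective_of_isIso e.hom
  have hδ : (e.hom ≫ δ).hom = (Algebra.TensorProduct.lmul' R : A ⊗[R] A →ₐ[R] A).toRingHom := by
    have : e.hom ≫ δ = CommRingCat.ofHom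
        (Algebra.TensorProduct.lmul' R : A ⊗[R] A →ₐ[R] A).toRingHom := by
      apply hp.hom_ext
      · rw [← Category.assoc, he₁, h₁]
        ext a
        simp
      · rw [← Category.assoc, he₂, h₂]
        ext a
        simp
    rw [this]
    rfl
  have hk : RingHom.ker (e.hom ≫ ρ).hom = KaehlerDifferential.ideal R A ^ n := by
    have hc (B : CommRingCat) (g : T ⟶ B) :
        RingHom.ker (e.hom ≫ g).hom = (RingHom.ker g.hom).comap e.hom.hom := by
      rw [CommRingCat.hom_comp, RingHom.comap_ker]
    have hδ' : RingHom.ker (e.hom ≫ δ).hom = KaehlerDifferential.ideal R A := by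
      rw [hδ]
      rfl
    rw [hc, hn, Ideal.comap_pow_of_bijective _ hb, ← hc, hδ']
  have hs : Function.Surjective (e.hom ≫ ρ).hom := by
    rw [CommRingCat.hom_comp]
    exact hρ.comp hb.2
  let q := (Ideal.quotEquivOfEq hk.symm).trans (RingHom.quotientKerEquivOfSurjective hs)
  constructor
  · refine (h.finiteProjectiveAlong_quotient_pow_left n).of_equiv q.toAddEquiv fun a m => ?_
    obtain ⟨m, rfl⟩ := Ideal.Quotient.mk_surjective m
    rw [← he₁]
    exact map_mul (e.hom ≫ ρ).hom _ m
  · refine (h.finiteProjectiveAlong_quotient_pow_right n).of_equiv q.toAddEquiv fun a m => ?_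
    obtain ⟨m, rfl⟩ := Ideal.Quotient.mk_surjective m
    rw [← he₂]
    exact map_mul (e.hom ≫ ρ).hom _ m

open Limits AlgebraicGeometry.Scheme

variable {X Y S : Scheme.{u}}

/-- Over `W` the immersion is a morphism of affine schemes surjective on functions, hence a closed
immersion; its range is then closed in `W`. This places `U ×_S U` inside the open set where the
diagonal is closed, without separatedness. -/
theorem AlgebraicGeometry.Scheme.Hom.le_coborderRange_of_surjective (g : X ⟶ Y) [IsImmersion g]
    {W : Y.Opens} (hW : IsAffineOpen W) (hW' : IsAffineOpen (g ⁻¹ᵁ W))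
    (h : Function.Surjective (g.app W)) : W ≤ g.coborderRange := by
  have : IsAffine W.toScheme := hW
  have : IsAffine (g ⁻¹ᵁ W).toScheme := hW'
  have hc : IsClosedImmersion (g ∣_ W) := by
    refine .of_surjective_of_isAffine _ ?_
    have key (W' : Y.Opens) (hW : W' = W) : Function.Surjective (g.app W') := by
      subst hW
      exact h
    rw [morphismRestrict_appTop]
    exact (ConcreteCategory.bijective_of_isIso (X.presheaf.map _)).2.comp (key _ W.ι_image_top)
  have hr : IsClosed (Set.range (g ∣_ W)) := (g ∣_ W).isClosedEmbedding.isClosed_range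
  have hr' : Set.range (g ∣_ W) = W.ι ⁻¹' Set.range g := by
    rw [morphismRestrict_base]
    exact Set.range_restrictPreimage _ _
  intro w hw
  have h' : (⟨w, hw⟩ : W) ∈ W.ι ⁻¹' coborder (Set.range g) := by
    rw [← W.ι.isOpenEmbedding.coborder_preimage, ← hr', hr.coborder_eq]
    trivial
  exact h'

theorem AlgebraicGeometry.Scheme.Hom.appLE_comp_appLE_of_comp_eq_id {g : X ⟶ Y} {p : Y ⟶ X}
    (h : g ≫ p = 𝟙 X) {U : X.Opens} {W : Y.Opens} (hp : W ≤ p ⁻¹ᵁ U) (hg : U ≤ g ⁻¹ᵁ W) :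
    p.appLE U W hp ≫ g.appLE W U hg = 𝟙 _ := by
  rw [Hom.appLE_comp_appLE]
  simp only [h]
  exact (Category.id_comp _).trans (X.presheaf.map_id _)

theorem AlgebraicGeometry.Scheme.Hom.appLE_comp_of_preimage_eq (g : X ⟶ Y) {U : X.Opens}
    {W : Y.Opens} (h : g ⁻¹ᵁ W = U) :
    RingHom.ker (g.appLE W U h.ge).hom = RingHom.ker (g.app W).hom ∧
      (Function.Surjective (g.appLE W U h.ge).hom → Function.Surjective (g.app W).hom) := by
  subst h
  rw [Hom.appLE_eq_app]
  exact ⟨rfl, id⟩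

namespace infinitesimalNbhd

variable (f : X ⟶ S)

/-- The open subscheme `U ×_S U` of `X ×_S X`. -/
abbrev square (U : X.Opens) : (pullback f f).Opens :=
  pullback.fst f f ⁻¹ᵁ U ⊓ pullback.snd f f ⁻¹ᵁ U

variable {f} {V : S.Opens} {U : X.Opens}

theorem isAffineOpen_square (e : U ≤ f ⁻¹ᵁ V) (hV : IsAffineOpen V) (hU : IsAffineOpen U) :
    IsAffineOpen (square f U) := by
  have : IsAffine _ := hV
  have : IsAffine _ := hU
  exact .of_isIso (Hom.isPullback_resLE (IsPullback.of_hasPullback f f) e e rfl).isoPullback.hom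

theorem isPushout_square (e : U ≤ f ⁻¹ᵁ V) (hV : IsAffineOpen V) (hU : IsAffineOpen U) :
    IsPushout (f.appLE V U e) (f.appLE V U e)
      ((pullback.fst f f).appLE U (square f U) inf_le_left)
      ((pullback.snd f f).appLE U (square f U) inf_le_right) :=
  (isIso_pushoutSection_iff (IsPullback.of_hasPullback f f) e e rfl).mp
    (isIso_pushoutSection_of_isAffineOpen (IsPullback.of_hasPullback f f) e e rfl hV hU hU)

theorem diagonal_preimage_square : pullback.diagonal f ⁻¹ᵁ square f U = U := by
  rw [square, Hom.preimage_inf, ← Hom.comp_preimage, ← Hom.comp_preimage, pullback.diagonal_fst,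
    pullback.diagonal_snd, Hom.id_preimage, inf_idem]

theorem ι_preimage_square (k : ℕ) : ι f k ⁻¹ᵁ square f U = fst f k ⁻¹ᵁ U :=
  (inf_eq_left.mpr (fst_preimage_eq_snd_preimage f k U).le : fst f k ⁻¹ᵁ U ⊓ snd f k ⁻¹ᵁ U = _)

theorem appLE_fst_diagonal : (pullback.fst f f).appLE U (square f U) inf_le_left ≫
    (pullback.diagonal f).appLE (square f U) U diagonal_preimage_square.ge = 𝟙 _ :=
  Hom.appLE_comp_appLE_of_comp_eq_id (pullback.diagonal_fst f) _ _

theorem appLE_snd_diagonal : (pullback.snd f f).appLE U (square f U) inf_le_right ≫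
    (pullback.diagonal f).appLE (square f U) U diagonal_preimage_square.ge = 𝟙 _ :=
  Hom.appLE_comp_appLE_of_comp_eq_id (pullback.diagonal_snd f) _ _

theorem square_le_coborderRange (e : U ≤ f ⁻¹ᵁ V) (hV : IsAffineOpen V) (hU : IsAffineOpen U) :
    square f U ≤ (pullback.diagonal f).coborderRange := by
  refine Hom.le_coborderRange_of_surjective _ (isAffineOpen_square e hV hU)
    (diagonal_preimage_square.symm ▸ hU) ?_
  -- The pullback of `a` under the first projection restricts to `a` on the diagonal.
  refine (Hom.appLE_comp_of_preimage_eq _ diagonal_preimage_square).2 fun a =>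
    ⟨(pullback.fst f f).appLE U (square f U) inf_le_left a, ?_⟩
  exact ConcreteCategory.congr_hom (appLE_fst_diagonal (f := f) (U := U)) a

theorem isAffineOpen_fst_preimage (e : U ≤ f ⁻¹ᵁ V) (hV : IsAffineOpen V) (hU : IsAffineOpen U)
    (k : ℕ) : IsAffineOpen (fst f k ⁻¹ᵁ U) := by
  rw [← ι_preimage_square]
  exact ((isAffineOpen_square e hV hU).preimage_of_isOpenImmersion
    (pullback.diagonal f).coborderRange.ι (by
      rw [Opens.opensRange_ι]; exact square_le_coborderRange e hV hU)).preimage (toCoborder f k)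

theorem ι_app_square (e : U ≤ f ⁻¹ᵁ V) (hV : IsAffineOpen V) (hU : IsAffineOpen U) (k : ℕ) :
    Function.Surjective ((ι f k).app (square f U)).hom ∧
      RingHom.ker ((ι f k).app (square f U)).hom =
        RingHom.ker ((pullback.diagonal f).appLE (square f U) U
          diagonal_preimage_square.ge).hom ^ (k + 1) := by
  let o := (pullback.diagonal f).coborderRange.ι
  let d := (pullback.diagonal f).liftCoborder
  have hW := square_le_coborderRange e hV hU
  rw [← Opens.opensRange_ι (pullback.diagonal f).coborderRange] at hW
  have hW' := (isAffineOpen_square e hV hU).preimage_of_isOpenImmersion o hW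
  have : IsIso (o.app (square f U)) := o.isIso_app _ hW
  have ho : Function.Bijective (o.app (square f U)).hom := ConcreteCategory.bijective_of_isIso _
  have hι : ((ι f k).app (square f U)).hom =
      ((toCoborder f k).app (o ⁻¹ᵁ square f U)).hom.comp (o.app (square f U)).hom := rfl
  constructor
  · rw [hι]
    exact ((toCoborder f k).app_surjective _ hW').comp ho.2
  · have hk : RingHom.ker ((ι f k).app (square f U)).hom =
        (RingHom.ker ((toCoborder f k).app (o ⁻¹ᵁ square f U)).hom).comap
          (o.app (square f U)).hom := rfl
    rw [hk, ker_toCoborder_app f k hW',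
      Ideal.comap_pow_of_bijective _ ho, RingHom.comap_ker,
      (Hom.appLE_comp_of_preimage_eq _ diagonal_preimage_square).1]
    have key (g : X ⟶ pullback f f) (hg : g = pullback.diagonal f) :
        RingHom.ker (g.app (square f U)).hom =
          RingHom.ker ((pullback.diagonal f).app (square f U)).hom := by
      rw [hg]
    rw [← key _ (Hom.liftCoborder_ι (pullback.diagonal f))]
    rfl

theorem finiteProjectiveAlong_app (e : U ≤ f ⁻¹ᵁ V) (hV : IsAffineOpen V) (hU : IsAffineOpen U)
    (h : letI := (f.appLE V U e).hom.toAlgebra; IsDifferentiallySmoothAlgebra Γ(S, V) Γ(X, U))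
    (k : ℕ) :
    FiniteProjectiveAlong ((fst f k).app U).hom Γ(infinitesimalNbhd f k, fst f k ⁻¹ᵁ U) ∧
      FiniteProjectiveAlong ((snd f k).app U).hom Γ(infinitesimalNbhd f k, snd f k ⁻¹ᵁ U) := by
  obtain ⟨hs, hk⟩ := ι_app_square e hV hU k
  obtain ⟨h₁, h₂⟩ := h.finiteProjectiveAlong_of_isPushout (isPushout_square e hV hU) _
    appLE_fst_diagonal appLE_snd_diagonal _ hs _ hk
  have key (g : infinitesimalNbhd f k ⟶ X) {O : (infinitesimalNbhd f k).Opens} (hO : O = g ⁻¹ᵁ U)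
      (hg : FiniteProjectiveAlong (g.appLE U O hO.le).hom Γ(infinitesimalNbhd f k, O)) :
      FiniteProjectiveAlong (g.app U).hom Γ(infinitesimalNbhd f k, g ⁻¹ᵁ U) := by
    subst hO
    rwa [Hom.appLE_eq_app] at hg
  have ha (r : pullback f f ⟶ X) (hr : square f U ≤ r ⁻¹ᵁ U) :
      r.appLE U (square f U) hr ≫ (ι f k).app (square f U) =
        (ι f k ≫ r).appLE U (ι f k ⁻¹ᵁ square f U) fun _ hx => hr hx := by
    rw [Hom.app_eq_appLE, Hom.appLE_comp_appLE]
  rw [ha] at h₁ h₂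
  exact ⟨key _ (ι_preimage_square k) h₁,
    key _ ((ι_preimage_square k).trans (fst_preimage_eq_snd_preimage f k U)) h₂⟩

end infinitesimalNbhd

end

/-! ### Comparison of pushforwards, and restriction between neighbourhoods. -/

namespace AlgebraicGeometry.Scheme.Modules

variable {X Z Z' : Scheme.{u}}

theorem nonempty_pushforward_iso (p q : Z ⟶ X) (h : ∀ U, p ⁻¹ᵁ U = q ⁻¹ᵁ U) (K : Z.Modules)
    (hK : ∀ (U : X.Opens) (a : Γ(X, U)) (m : Γ(K, p ⁻¹ᵁ U)),
      p.app U a • m = q.appLE U (p ⁻¹ᵁ U) (h U).le a • m) :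
    Nonempty ((pushforward p).obj K ≅ (pushforward q).obj K) := by
  let φ : ((pushforward p).obj K).presheaf ⟶ ((pushforward q).obj K).presheaf :=
    { app U := K.presheaf.map (homOfLE (h U.unop).ge).op
      naturality U V f := by
        change K.presheaf.map _ ≫ K.presheaf.map _ = K.presheaf.map _ ≫ K.presheaf.map _
        rw [← Functor.map_comp, ← Functor.map_comp]
        rfl }
  let ψ : (pushforward p).obj K ⟶ (pushforward q).obj K :=
    ⟨PresheafOfModules.homMk φ fun U r m => by
      have h₀ := ConcreteCategory.congr_hom
        (q.appLE_map (h U.unop).le (homOfLE (h U.unop).ge).op) r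
      rw [Hom.appLE_eq_app] at h₀
      refine (congrArg (K.presheaf.map (homOfLE (h U.unop).ge).op) (hK U.unop r m)).trans
        ((map_smul K (homOfLE (h U.unop).ge) _ _).trans ?_)
      exact congrArg (· • K.presheaf.map (homOfLE (h U.unop).ge).op m) h₀⟩
  have : IsIso ψ := isIso_of_bijective _ fun W => by
    have : IsIso (K.presheaf.map (homOfLE (h W).ge).op) := by
      rw [show homOfLE (h W).ge = eqToHom (h W).symm from rfl]
      infer_instance
    exact ConcreteCategory.bijective_of_isIso (K.presheaf.map (homOfLE (h W).ge).op)
  exact ⟨asIso ψ⟩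

/-- The map is the adjoint of the unit for `q₀`. It sends pulled-back sections to pulled-back
sections, hence bases to bases; applied to `transition`, it becomes the restriction of principal
parts to lower order. -/
theorem exists_pullback_hom (i : Z ⟶ Z') (q : Z' ⟶ X) (q₀ : Z ⟶ X) (h : i ≫ q = q₀)
    (E : X.Modules) :
    ∃ φ : (pullback q).obj E ⟶ (pushforward i).obj ((pullback q₀).obj E),
      ∀ (U : X.Opens) (n : ℕ) (s : Fin n → Γ(E, U)), IsBasisOn E U s →
        IsBasisOn ((pullback q₀).obj E) (i ⁻¹ᵁ q ⁻¹ᵁ U)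
          fun j => φ.app (q ⁻¹ᵁ U) (pullbackSection q (s j)) := by
  subst h
  let φ := ((pullbackPushforwardAdjunction q).homEquiv E
    ((pushforward i).obj ((pullback (i ≫ q)).obj E))).symm
      ((pullbackPushforwardAdjunction (i ≫ q)).unit.app E)
  refine ⟨φ, fun U n s hs => ?_⟩
  have h (j) : φ.app (q ⁻¹ᵁ U) (pullbackSection q (s j)) = pullbackSection (i ≫ q) (s j) := by
    have := ((pullbackPushforwardAdjunction q).homEquiv E
      ((pushforward i).obj ((pullback (i ≫ q)).obj E))).apply_symm_apply
        ((pullbackPushforwardAdjunction (i ≫ q)).unit.app E)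
    rw [Adjunction.homEquiv_unit] at this
    exact congrArg (fun ψ : E ⟶ (pushforward (i ≫ q)).obj ((pullback (i ≫ q)).obj E) =>
      ψ.app U (s j)) this
  have hs' := ((hs.reindex (Equiv.ulift.{u} : ULift (Fin n) ≃ _)).pullback (i ≫ q)).reindex
    Equiv.ulift.symm
  rw [funext h]
  exact hs'

/-- Since `φ` carries a basis to a basis, a section in its kernel has all coordinates in the kernel
of restriction along `i`, where `a` and `b` act alike. -/
theorem IsBasisOn.smul_eq_smul_of_app_eq_zero {i : Z ⟶ Z'} {F' : Z'.Modules} {F : Z.Modules}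
    (φ : F' ⟶ (Modules.pushforward i).obj F) {V : Z'.Opens} {n : ℕ} {t : Fin n → Γ(F', V)}
    (ht : IsBasisOn F' V t) (ht' : IsBasisOn F (i ⁻¹ᵁ V) fun j => φ.app V (t j)) {W : Z'.Opens}
    (hW : W ≤ V) {a b : Γ(Z', W)} (hab : ∀ c : Γ(Z', W), i.app W c = 0 → a * c = b * c)
    (m : Γ(F', W)) (hm : φ.app W m = 0) : a • m = b • m := by
  obtain ⟨c, rfl⟩ := (ht W hW).2 m
  dsimp only at hm ⊢
  have hc (j) : i.app W (c j) = 0 := by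
    rw [Hom.app_sum_smul] at hm
    have h0 : (fun j => i.app W (c j)) = 0 := by
      refine (ht' (i ⁻¹ᵁ W) (i.preimage_mono hW)).1 ?_
      refine Eq.trans ?_ (hm.trans ?_)
      · rfl
      · simp
        rfl
    exact congrFun h0 j
  simp_rw [Finset.smul_sum, smul_smul, fun j => hab _ (hc j)]

end AlgebraicGeometry.Scheme.Modules

theorem KGroup.mk_eq_add {X : Scheme.{u}} {T : ShortComplex X.Modules} (hT : T.ShortExact)
    (h₁ : IsLocallyFreeOfFiniteRank T.X₁) (h₂ : IsLocallyFreeOfFiniteRank T.X₂)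
    (h₃ : IsLocallyFreeOfFiniteRank T.X₃) : mk T.X₂ h₂ = mk T.X₁ h₁ + mk T.X₃ h₃ := by
  refine QuotientAddGroup.eq.2 ?_
  -- Equality of cosets yields `-[X₂] + ([X₁] + [X₃])`, the negative of the defining relation.
  rw [← neg_mem_iff]
  refine AddSubgroup.subset_closure ⟨T, hT, h₁, h₂, h₃, ?_⟩
  rw [neg_add_rev, neg_neg, neg_add_rev, sub_sub, sub_eq_add_neg, neg_add_rev, add_comm]

/-! ### Finite locally free morphisms and exact sequences of pushforwards. -/

namespace AlgebraicGeometry.Scheme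

open Modules

variable {X Y Z Z' : Scheme.{u}}

/-- An affine morphism `r` such that `r_* 𝒪` is locally free of finite rank. -/
structure Hom.IsFiniteLocallyFree (r : Y ⟶ X) : Prop where
  isAffineHom : IsAffineHom r
  exists_isBasisOn (x : X) : ∃ (U : X.Opens) (n : ℕ)
    (b : Fin n → Γ((pushforward r).obj (unit Y), U)), x ∈ U ∧ IsBasisOn _ U b

theorem Hom.IsFiniteLocallyFree.exists_isBasisOn_pushforward {r : Y ⟶ X}
    (hr : r.IsFiniteLocallyFree) (F : Y.Modules) {x : X} {V : X.Opens} (hx : x ∈ V) {n : ℕ}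
    {t : Fin n → Γ(F, r ⁻¹ᵁ V)} (ht : IsBasisOn F (r ⁻¹ᵁ V) t) :
    ∃ (U : X.Opens) (κ : Type) (_ : Fintype κ) (s : κ → Γ((pushforward r).obj F, U)),
      x ∈ U ∧ IsBasisOn ((pushforward r).obj F) U s := by
  obtain ⟨U, m, b, hxU, hb⟩ := hr.exists_isBasisOn x
  exact ⟨U ⊓ V, _, inferInstance, _, ⟨hxU, hx⟩, (hb.restrict inf_le_left).pushforward r
    (ht.restrict (r.preimage_mono inf_le_right))⟩

/-- Pushforward is left exact, so only surjectivity on the right needs an argument. On an affine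
open a section is expanded in the image basis, and its coefficients lift because `i` is a closed
immersion and `r` is affine. The isomorphism `θ` lets the sequences for two different `r` share
literally the same first term `K`. -/
theorem Hom.IsFiniteLocallyFree.exists_shortExact {i : Z ⟶ Z'} [IsClosedImmersion i] {r : Z' ⟶ X}
    {r₀ : Z ⟶ X} (h : i ≫ r = r₀) (hr : r.IsFiniteLocallyFree) (hr₀ : r₀.IsFiniteLocallyFree)
    {F' : Z'.Modules} {F : Z.Modules} (φ : F' ⟶ (pushforward i).obj F)
    (hφ : ∀ x : X, ∃ (U : X.Opens) (n : ℕ) (t : Fin n → Γ(F', r ⁻¹ᵁ U)), x ∈ U ∧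
      IsBasisOn F' (r ⁻¹ᵁ U) t ∧ IsBasisOn F (i ⁻¹ᵁ r ⁻¹ᵁ U) fun j => φ.app (r ⁻¹ᵁ U) (t j))
    {K : X.Modules} (θ : K ≅ (pushforward r).obj (Limits.kernel φ)) :
    ∃ (h₁ : IsLocallyFreeOfFiniteRank K)
      (h₂ : IsLocallyFreeOfFiniteRank ((pushforward r).obj F'))
      (h₃ : IsLocallyFreeOfFiniteRank ((pushforward r₀).obj F)),
      KGroup.mk _ h₂ = KGroup.mk _ h₁ + KGroup.mk _ h₃ := by
  subst h
  have := hr.isAffineHom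
  let T₀ : ShortComplex Z'.Modules := ⟨Limits.kernel.ι φ, φ, Limits.kernel.condition φ⟩
  have hT₀ : T₀.Exact := T₀.exact_of_f_is_kernel (Limits.kernelIsKernel φ)
  have hmono : Mono T₀.f := inferInstanceAs (Mono (Limits.kernel.ι φ))
  let T : ShortComplex X.Modules :=
    ⟨θ.hom ≫ (pushforward r).map (Limits.kernel.ι φ),
      (pushforward r).map φ ≫ (pushforwardComp i r).hom.app F, by
        rw [Category.assoc, ← Functor.map_comp_assoc, Limits.kernel.condition]
        simp⟩
  have hex : T.Exact := by
    have h₁ : (T₀.map (pushforward r)).Exact :=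
      hT₀.map_of_mono_of_preservesKernel (pushforward r) hmono inferInstance
    exact ShortComplex.exact_of_iso (S₁ := T₀.map (pushforward r)) (S₂ := T)
      (ShortComplex.isoMk θ.symm (Iso.refl _) ((pushforwardComp i r).app F)
        ((θ.inv_hom_id_assoc _).trans (Category.comp_id _).symm) (Category.id_comp _)) h₁
  have hf : Mono T.f := by
    have : Mono ((pushforward r).map (Limits.kernel.ι φ)) := inferInstance
    exact mono_comp _ _
  have hsurj (U : X.Opens) (hU : IsAffineOpen U) (n : ℕ) (t : Fin n → Γ(F', r ⁻¹ᵁ U))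
      (ht : IsBasisOn F (i ⁻¹ᵁ r ⁻¹ᵁ U) fun j => φ.app (r ⁻¹ᵁ U) (t j)) :
      Function.Surjective (T.g.app U) := by
    intro m
    obtain ⟨c, hc⟩ := (ht _ le_rfl).2 m
    have hd (j) := i.app_surjective _ (hU.preimage r) (c j)
    choose d hd using hd
    refine ⟨(show Γ(F', r ⁻¹ᵁ U) from
      ∑ j, d j • F'.presheaf.map (homOfLE le_rfl).op (t j)), ?_⟩
    refine (Hom.app_sum_smul φ le_rfl t d).trans (Eq.trans ?_ hc)
    simp_rw [← hd]
    rfl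
  have hloc (x : X) (O : X.Opens) (hx : x ∈ O) : ∃ (U : X.Opens) (_ : U ≤ O) (n : ℕ)
      (t : Fin n → Γ(F', r ⁻¹ᵁ U)), x ∈ U ∧ IsAffineOpen U ∧ IsBasisOn F' (r ⁻¹ᵁ U) t ∧
        IsBasisOn F (i ⁻¹ᵁ r ⁻¹ᵁ U) fun j => φ.app (r ⁻¹ᵁ U) (t j) := by
    obtain ⟨V, n, t, hxV, ht, ht'⟩ := hφ x
    obtain ⟨_, ⟨U, hU, rfl⟩, hxU, hUV⟩ :=
      X.isBasis_affineOpens.exists_subset_of_mem_open (show x ∈ V ⊓ O from ⟨hxV, hx⟩)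
        (V ⊓ O).isOpen
    have hUV' : U ≤ V := fun y hy => (hUV hy).1
    refine ⟨U, fun y hy => (hUV hy).2, n, _, hxU, hU, ht.restrict (r.preimage_mono hUV'), ?_⟩
    simp_rw [Modules.Hom.app_map]
    exact ht'.restrict (i.preimage_mono (r.preimage_mono hUV'))
  have hg : Epi T.g := epi_of_locally_surjective _ fun O m x hx => by
    obtain ⟨U, hUO, n, t, hxU, hU, ht, ht'⟩ := hloc x O hx
    obtain ⟨m', hm'⟩ := hsurj U hU n t ht' (T.X₃.presheaf.map (homOfLE hUO).op m)
    exact ⟨U, hUO, m', hxU, hm'⟩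
  have hT : T.ShortExact := ⟨hex⟩
  have h₂ : IsLocallyFreeOfFiniteRank T.X₂ := isLocallyFreeOfFiniteRank_of_isBasisOn fun x => by
    obtain ⟨U, hUO, n, t, hxU, hU, ht, ht'⟩ := hloc x ⊤ trivial
    exact hr.exists_isBasisOn_pushforward F' hxU ht
  have h₃ : IsLocallyFreeOfFiniteRank T.X₃ := isLocallyFreeOfFiniteRank_of_isBasisOn fun x => by
    obtain ⟨U, hUO, n, t, hxU, hU, ht, ht'⟩ := hloc x ⊤ trivial
    exact hr₀.exists_isBasisOn_pushforward F hxU ht'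
  -- On a small affine open both other terms have bases and the map is surjective on sections, so
  -- the kernel has local bases too.
  have h₁ : IsLocallyFreeOfFiniteRank T.X₁ := isLocallyFreeOfFiniteRank_of_isBasisOn fun x => by
    obtain ⟨V₂, n₂, s₂, hx₂, hs₂⟩ := Modules.exists_isBasisOn h₂ x
    obtain ⟨V₃, n₃, s₃, hx₃, hs₃⟩ := Modules.exists_isBasisOn h₃ x
    obtain ⟨U, hUO, n, t, hxU, hU, ht, ht'⟩ := hloc x (V₂ ⊓ V₃) ⟨hx₂, hx₃⟩
    obtain ⟨V, m, v, hxV, hv⟩ := exists_isBasisOn_kernel hT hU (hs₂.restrict (hUO.trans inf_le_left))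
      (hs₃.restrict (hUO.trans inf_le_right)) (hsurj U hU n t ht') hxU
    exact ⟨V, _, inferInstance, v, hxV, hv⟩
  exact ⟨h₁, h₂, h₃, KGroup.mk_eq_add hT h₁ h₂ h₃⟩

end AlgebraicGeometry.Scheme

/-! ### Equality of classes by induction on the order. -/

section

open AlgebraicGeometry.Scheme AlgebraicGeometry.Scheme.Modules

namespace AlgebraicGeometry.Scheme

variable {X Y Z Z' : Scheme.{u}}

theorem Hom.IsFiniteLocallyFree.of_finiteProjectiveAlong (r : Y ⟶ X)
    (h : ∀ x : X, ∃ U : X.Opens, x ∈ U ∧ IsAffineOpen U ∧ IsAffineOpen (r ⁻¹ᵁ U) ∧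
      FiniteProjectiveAlong (r.app U).hom Γ(Y, r ⁻¹ᵁ U)) : r.IsFiniteLocallyFree where
  isAffineHom := isAffineHom_of_forall_exists_isAffineOpen r fun x => by
    obtain ⟨U, hx, hU, hU', -⟩ := h x
    exact ⟨U, hx, hU, hU'⟩
  exists_isBasisOn x := by
    obtain ⟨U, hx, hU, hU', h₁, h₂⟩ := h x
    have : Module.Finite Γ(X, U) Γ((pushforward r).obj (unit Y), U) := h₁
    have : Module.Projective Γ(X, U) Γ((pushforward r).obj (unit Y), U) := h₂
    obtain ⟨a, n, s, hxa, hs⟩ := ((localizesOn_unit hU').pushforward r).exists_isBasisOn hU hx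
    exact ⟨_, n, s, hxa, hs⟩

theorem Modules.IsBasisOn.pullback_fin (q : Y ⟶ X) {M : X.Modules} {U : X.Opens} {n : ℕ}
    {s : Fin n → Γ(M, U)} (hs : IsBasisOn M U s) :
    IsBasisOn ((Modules.pullback q).obj M) (q ⁻¹ᵁ U) fun j => pullbackSection q (s j) :=
  ((hs.reindex (Equiv.ulift.{u} : ULift (Fin n) ≃ _)).pullback q).reindex Equiv.ulift.symm

theorem Hom.IsFiniteLocallyFree.isLocallyFreeOfFiniteRank_pushforward_pullback {p q : Y ⟶ X}
    (hp : p.IsFiniteLocallyFree) (hpq : ∀ U, p ⁻¹ᵁ U = q ⁻¹ᵁ U) {E : X.Modules}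
    (hE : IsLocallyFreeOfFiniteRank E) :
    IsLocallyFreeOfFiniteRank ((pushforward p).obj ((pullback q).obj E)) :=
  isLocallyFreeOfFiniteRank_of_isBasisOn fun x => by
    obtain ⟨U, n, s, hx, hs⟩ := Modules.exists_isBasisOn hE x
    obtain ⟨t, ht⟩ : ∃ t : Fin n → Γ((pullback q).obj E, p ⁻¹ᵁ U), IsBasisOn _ _ t := by
      rw [hpq]
      exact ⟨_, hs.pullback_fin q⟩
    exact hp.exists_isBasisOn_pushforward _ hx ht

theorem Hom.IsFiniteLocallyFree.mk_pushforward_pullback_eq {i : Z ⟶ Z'} [IsClosedImmersion i]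
    {p q : Z' ⟶ X} {p₀ q₀ : Z ⟶ X} (hp₀ : i ≫ p = p₀) (hq₀ : i ≫ q = q₀)
    (hp : p.IsFiniteLocallyFree) (hq : q.IsFiniteLocallyFree)
    (hp₀' : p₀.IsFiniteLocallyFree) (hq₀' : q₀.IsFiniteLocallyFree)
    (hpq : ∀ U, p ⁻¹ᵁ U = q ⁻¹ᵁ U)
    (hi : ∀ {U : X.Opens} (a : Γ(X, U)) {V : Z'.Opens} (_ : V ≤ p ⁻¹ᵁ U) {z : Z'} (_ : z ∈ V),
      ∃ (W : Z'.Opens) (h₁ : W ≤ p ⁻¹ᵁ U) (h₂ : W ≤ q ⁻¹ᵁ U), W ≤ V ∧ z ∈ W ∧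
        ∀ c : Γ(Z', W), i.app W c = 0 → p.appLE U W h₁ a * c = q.appLE U W h₂ a * c)
    {E : X.Modules} (hE : IsLocallyFreeOfFiniteRank E)
    (hl₀ : IsLocallyFreeOfFiniteRank ((pushforward p₀).obj ((pullback q₀).obj E)))
    (hr₀ : IsLocallyFreeOfFiniteRank ((pushforward q₀).obj ((pullback q₀).obj E)))
    (h₀ : KGroup.mk _ hl₀ = KGroup.mk _ hr₀) :
    ∃ (hl : IsLocallyFreeOfFiniteRank ((pushforward p).obj ((pullback q).obj E)))
      (hr : IsLocallyFreeOfFiniteRank ((pushforward q).obj ((pullback q).obj E))),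
      KGroup.mk _ hl = KGroup.mk _ hr := by
  obtain ⟨φ, hφ⟩ := exists_pullback_hom i q q₀ hq₀ E
  have hφq (x : X) : ∃ (U : X.Opens) (n : ℕ) (t : Fin n → Γ((pullback q).obj E, q ⁻¹ᵁ U)),
      x ∈ U ∧ IsBasisOn _ (q ⁻¹ᵁ U) t ∧
        IsBasisOn ((pullback q₀).obj E) (i ⁻¹ᵁ q ⁻¹ᵁ U) fun j => φ.app (q ⁻¹ᵁ U) (t j) := by
    obtain ⟨U, n, s, hx, hs⟩ := Modules.exists_isBasisOn hE x
    exact ⟨U, n, _, hx, hs.pullback_fin q, hφ U n s hs⟩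
  have hφp (x : X) : ∃ (U : X.Opens) (n : ℕ) (t : Fin n → Γ((pullback q).obj E, p ⁻¹ᵁ U)),
      x ∈ U ∧ IsBasisOn _ (p ⁻¹ᵁ U) t ∧
        IsBasisOn ((pullback q₀).obj E) (i ⁻¹ᵁ p ⁻¹ᵁ U) fun j => φ.app (p ⁻¹ᵁ U) (t j) := by
    obtain ⟨U, h⟩ := hφq x
    refine ⟨U, ?_⟩
    rwa [hpq]
  -- Equality of the two actions on the kernel is local, so it is checked on the opens `W` from
  -- `hi`, shrunk to lie where a basis exists.
  obtain ⟨θ⟩ := nonempty_pushforward_iso p q hpq (Limits.kernel φ) fun U a m => by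
    refine section_ext _ fun z hz => ?_
    obtain ⟨U', n, t, hzU', ht, ht'⟩ := hφp (p z)
    obtain ⟨W, h₁, h₂, hWV, hzW, hW⟩ := hi a (V := p ⁻¹ᵁ U ⊓ p ⁻¹ᵁ U') inf_le_left ⟨hz, hzU'⟩
    refine ⟨W, h₁, hzW, ?_⟩
    have hker (m : Γ(Limits.kernel φ, W)) : φ.app W ((Limits.kernel.ι φ).app W m) = 0 :=
      congrArg (fun ψ : Limits.kernel φ ⟶ (pushforward i).obj _ => ψ.app W m)
        (Limits.kernel.condition φ)
    rw [map_smul, map_smul]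
    apply injective_app_of_mono (Limits.kernel.ι φ) W
    rw [Modules.Hom.app_smul, Modules.Hom.app_smul]
    have hp' := ConcreteCategory.congr_hom
      (p.appLE_map (U := U) (V := p ⁻¹ᵁ U) le_rfl (homOfLE h₁).op) a
    have hq' := ConcreteCategory.congr_hom (q.appLE_map (hpq U).le (homOfLE h₁).op) a
    rw [Hom.appLE_eq_app] at hp'
    rw [CommRingCat.comp_apply] at hp' hq'
    rw [hp', hq']
    exact IsBasisOn.smul_eq_smul_of_app_eq_zero φ ht ht' (hWV.trans inf_le_right) hW _ (hker _)
  -- Both sequences start with `p_* ker φ`: directly for `p`, through `θ` for `q`. The kernel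
  -- contributions therefore cancel.
  obtain ⟨h₁, h₂, h₃, h⟩ := hp.exists_shortExact hp₀ hp₀' φ hφp (Iso.refl _)
  obtain ⟨h₁', h₂', h₃', h'⟩ := hq.exists_shortExact hq₀ hq₀' φ hφq θ
  exact ⟨h₂, h₂', h.trans ((congrArg _ h₀).trans h'.symm)⟩

end AlgebraicGeometry.Scheme

namespace infinitesimalNbhd

variable {X S : Scheme.{u}} {f : X ⟶ S}

theorem isFiniteLocallyFree_fst (hf : IsDifferentiallySmooth f) (k : ℕ) :
    (fst f k).IsFiniteLocallyFree :=
  .of_finiteProjectiveAlong _ fun x => by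
    obtain ⟨V, U, e, hV, hU, hx, h⟩ := hf x
    exact ⟨U, hx, hU, isAffineOpen_fst_preimage e hV hU k,
      (finiteProjectiveAlong_app e hV hU h k).1⟩

theorem isFiniteLocallyFree_snd (hf : IsDifferentiallySmooth f) (k : ℕ) :
    (snd f k).IsFiniteLocallyFree :=
  .of_finiteProjectiveAlong _ fun x => by
    obtain ⟨V, U, e, hV, hU, hx, h⟩ := hf x
    exact ⟨U, hx, hU, fst_preimage_eq_snd_preimage f k U ▸ isAffineOpen_fst_preimage e hV hU k,
      (finiteProjectiveAlong_app e hV hU h k).2⟩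

end infinitesimalNbhd

theorem KGroup.mk_congr {X : Scheme.{u}} {M N : X.Modules} (h : M = N)
    (hM : IsLocallyFreeOfFiniteRank M) (hN : IsLocallyFreeOfFiniteRank N) :
    mk M hM = mk N hN := by
  subst h
  rfl

open infinitesimalNbhd in
theorem mk_jetLeft_eq_mk_jetRight {X S : Scheme.{u}} {f : X ⟶ S} (hf : IsDifferentiallySmooth f)
    {E : X.Modules} (hE : IsLocallyFreeOfFiniteRank E) (k : ℕ) :
    ∃ (hl : IsLocallyFreeOfFiniteRank (jetLeft f k E))
      (hr : IsLocallyFreeOfFiniteRank (jetRight f k E)),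
      KGroup.mk (jetLeft f k E) hl = KGroup.mk (jetRight f k E) hr := by
  -- Starting at order `0` makes the base case an equality of modules, since the two projections
  -- coincide there.
  induction k with
  | zero =>
    refine ⟨(isFiniteLocallyFree_fst hf 0).isLocallyFreeOfFiniteRank_pushforward_pullback
        (fst_preimage_eq_snd_preimage f 0) hE,
      (isFiniteLocallyFree_snd hf 0).isLocallyFreeOfFiniteRank_pushforward_pullback
        (fun _ => rfl) hE, KGroup.mk_congr ?_ _ _⟩
    rw [jetLeft, jetRight, fst_zero_eq_snd_zero]
  | succ k ih =>
    obtain ⟨hl, hr, h⟩ := ih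
    exact Hom.IsFiniteLocallyFree.mk_pushforward_pullback_eq (transition_fst f k)
      (transition_snd f k) (isFiniteLocallyFree_fst hf (k + 1))
      (isFiniteLocallyFree_snd hf (k + 1)) (isFiniteLocallyFree_fst hf k)
      (isFiniteLocallyFree_snd hf k) (fst_preimage_eq_snd_preimage f (k + 1))
      (exists_fst_mul_eq_snd_mul f k) hE hl hr h

end

end

theorem theorem4p6 {X S : Scheme.{u}} (f : X ⟶ S) (hf : IsDifferentiallySmooth f)
    (E : X.Modules) (hE : IsLocallyFreeOfFiniteRank E) (k : ℕ) (hk : 1 ≤ k) :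
    ∃ (hl : IsLocallyFreeOfFiniteRank (jetLeft f k E))
      (hr : IsLocallyFreeOfFiniteRank (jetRight f k E)),
      KGroup.mk (jetLeft f k E) hl = KGroup.mk (jetRight f k E) hr :=
  mk_jetLeft_eq_mk_jetRight hf hE k
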